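/- **Theorem 5.2 (characterization of tilt-stable local minimizers for NLP).** Let $0\le s\le m$ and consider the nonlinear program $$\text{minimize }\varphi_0(x)\ \text{ subject to }\ \varphi_i(x)\le 0\ (i=1,\dots,s),\quad \varphi_i(x)=0\ (i=s+1,\dots,m),\qquad x\in\mathbb R^n, \tag{NLP}$$ where $\varphi_0,\dots,\varphi_m:\mathbb R^n\to\mathbb R$, and let $\bar x$ be a feasible point. Let $\varphi:\mathbb R^n\to\overline{\mathbb R}$ equal $\varphi_0$ on the feasible set and $+\infty$ elsewhere. The point $\bar x$ is a *tilt-stable local minimizer* of (NLP) if there is $\gamma>0$ such that the mapping $$M:\ y\mapsto \operatorname{argmin}\{\varphi(x)-\varphi(\bar x)-\langle y,x-\bar x\rangle \;:\; \|x-\bar x\|\le\gamma\}$$ is single-valued and Lipschitz continuous on some neighborhood of $y=0$, with $M(0)=\bar x$. Assume that each $\varphi_i$, $i=0,\dots,m$, is continuously differentiable around $\bar x$ with gradient mapping $\nabla\varphi_i$ strictly differentiable at $\bar x$, and that LICQ holds at $\bar x$: the gradients $\nabla\varphi_i(\bar x)$ of the active constraints ($1\le i\le m$, $\varphi_i(\bar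 x)=0$) are linearly independent. Let $L(x,\lambda)=\varphi_0(x)+\sum_{i=1}^m\lambda_i\varphi_i(x)$. A *multiplier* at $\bar x$ is a vector $\lambda\in\mathbb R^s_+\times\mathbb R^{m-s}$ with $\lambda_i=0$ whenever $\varphi_i(\bar x)\neq0$ and $\nabla_xL(\bar x,\lambda)=0$. The *strong second-order optimality condition* (SSOC) holds at $\bar x$ with the multiplier $\lambda$ if $$\langle u,\nabla^2_{xx}L(\bar x,\lambda)u\rangle>0\quad\text{for all } 0\ne u\in S,$$ $$S=\{u\in\mathbb R^n:\ \langle\nabla\varphi_i(\bar x),u\rangle=0\ \text{ for } i=s+1,\dots,m \text{ and for all } i\le s \text{ with } \lambda_i>0\}.$$ Then: (i) If $\bar x$ is a tilt-stable local minimizer of (NLP), then there is a unique multiplier $\bar\lambda$ at $\bar x$, and SSOC holds at $\bar x$ with $\bar\lambda$. (ii) Conversely, if SSOC holds at $\bar x$ with some multiplier $\bar\lambda$ at $\bar x$, then $\bar x$ is a tilt-stable local minimizer of (NLP). -/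

import Mathlib

open scoped Topology Gradient InnerProductSpace NNReal

noncomputable section

/-- The space `ℝⁿ` with its Euclidean norm and inner product. -/
abbrev Rn (n : ℕ) : Type := EuclideanSpace ℝ (Fin n)

/-- The set of minimizers of the tilted function `φ(x) - φ(x̄) - ⟨y, x - x̄⟩` over the closed ball
of radius `γ` around `x̄`. -/
def tiltArgmin {n : ℕ} (φ : Rn n → EReal) (xbar : Rn n) (γ : ℝ) (y : Rn n) : Set (Rn n) :=
  {x | x ∈ Metric.closedBall xbar γ ∧
    IsMinOn (fun z => φ z - φ xbar - ((⟪y, z - xbar⟫_ℝ : ℝ) : EReal))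
      (Metric.closedBall xbar γ) x}

/-- `x̄` is a tilt-stable local minimizer of the extended-real-valued function `φ`: `φ` is finite
at `x̄` and, for some `γ > 0`, the mapping `y ↦ tiltArgmin φ x̄ γ y` is single-valued and Lipschitz
continuous on a neighbourhood of `0`, with value `x̄` at `y = 0`. -/
def IsTiltStable {n : ℕ} (φ : Rn n → EReal) (xbar : Rn n) : Prop :=
  φ xbar ≠ ⊥ ∧ φ xbar ≠ ⊤ ∧
    ∃ γ : ℝ, 0 < γ ∧ ∃ V ∈ 𝓝 (0 : Rn n), ∃ M : Rn n → Rn n, ∃ K : ℝ≥0,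
      (∀ y ∈ V, tiltArgmin φ xbar γ y = {M y}) ∧ LipschitzOnWith K M V ∧ M 0 = xbar

/-- `f` is continuously differentiable around `x`, and its derivative, seen as the gradient mapping
`∇f : ℝⁿ → ℝⁿ`, is strictly differentiable at `x`. -/
def SmoothWithStrictDeriv {n : ℕ} (f : Rn n → ℝ) (x : Rn n) : Prop :=
  ContDiffAt ℝ 1 f x ∧ ∃ H : Rn n →L[ℝ] Rn n, HasStrictFDerivAt (∇ f) H x

namespace NLP

variable {n m : ℕ}

/-- The feasible set: the constraints with (zero-based) index `i < s` are inequalities `φᵢ ≤ 0`,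
the remaining ones are equalities `φᵢ = 0`. -/
def feasibleSet (s : ℕ) (φ : Fin m → Rn n → ℝ) : Set (Rn n) :=
  {x | ∀ i : Fin m, (i.val < s → φ i x ≤ 0) ∧ (s ≤ i.val → φ i x = 0)}

open Classical in
/-- The nonlinear program in unconstrained format: the objective plus the indicator function of
the feasible set. -/
def extObjective (s : ℕ) (φ₀ : Rn n → ℝ) (φ : Fin m → Rn n → ℝ) (x : Rn n) : EReal :=
  if x ∈ feasibleSet s φ then ((φ₀ x : ℝ) : EReal) else ⊤

/-- `x̄` is a tilt-stable local minimizer of the nonlinear program. -/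
def IsTiltStableMin (s : ℕ) (φ₀ : Rn n → ℝ) (φ : Fin m → Rn n → ℝ) (xbar : Rn n) : Prop :=
  IsTiltStable (extObjective s φ₀ φ) xbar

/-- Linear independence constraint qualification at a feasible point: the gradients of the active
constraints (which include all equality constraints) are linearly independent. -/
def LICQ (φ : Fin m → Rn n → ℝ) (xbar : Rn n) : Prop :=
  LinearIndependent ℝ (fun i : {i : Fin m // φ i xbar = 0} => ∇ (φ i.val) xbar)

/-- The Lagrangian `L(x, l) = φ₀(x) + ∑ lᵢ φᵢ(x)`. -/
def lagrangian (φ₀ : Rn n → ℝ) (φ : Fin m → Rn n → ℝ) (x : Rn n) (l : Fin m → ℝ) : ℝ :=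
  φ₀ x + ∑ i, l i * φ i x

/-- `l` is a Lagrange multiplier at `x̄`: `l ∈ ℝˢ₊ × ℝᵐ⁻ˢ`, `lᵢ = 0` for every inactive
constraint, and `∇φ₀(x̄) + ∑ lᵢ ∇φᵢ(x̄) = 0`. -/
def IsMultiplier (s : ℕ) (φ₀ : Rn n → ℝ) (φ : Fin m → Rn n → ℝ) (xbar : Rn n)
    (l : Fin m → ℝ) : Prop :=
  (∀ i : Fin m, i.val < s → 0 ≤ l i) ∧ (∀ i, φ i xbar ≠ 0 → l i = 0) ∧
    ∇ φ₀ xbar + ∑ i, l i • ∇ (φ i) xbar = 0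

/-- The Hessian `∇²ₓₓ L(x̄, l)`, as the derivative at `x̄` of the gradient of `L(·, l)`. -/
def hessLagrangian (φ₀ : Rn n → ℝ) (φ : Fin m → Rn n → ℝ) (xbar : Rn n) (l : Fin m → ℝ) :
    Rn n →L[ℝ] Rn n :=
  fderiv ℝ (∇ (fun x => lagrangian φ₀ φ x l)) xbar

/-- The subspace `S` of all `u` orthogonal to the gradients at `x̄` of the equality constraints and
of the inequality constraints with positive multiplier. -/
def strongSubspace (s : ℕ) (φ : Fin m → Rn n → ℝ) (xbar : Rn n) (l : Fin m → ℝ) :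
    Submodule ℝ (Rn n) where
  carrier := {u | ∀ i : Fin m, (s ≤ i.val ∨ 0 < l i) → ⟪∇ (φ i) xbar, u⟫_ℝ = 0}
  zero_mem' := by
    intro i _
    exact inner_zero_right _
  add_mem' := by
    intro a b ha hb i hi
    rw [inner_add_right, ha i hi, hb i hi, add_zero]
  smul_mem' := by
    intro c a ha i hi
    rw [inner_smul_right, ha i hi, mul_zero]

/-- The strong second-order optimality condition at `x̄` with the multiplier `l`. -/
def SSOC (s : ℕ) (φ₀ : Rn n → ℝ) (φ : Fin m → Rn n → ℝ) (xbar : Rn n) (l : Fin m → ℝ) : Prop :=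
  ∀ u ∈ strongSubspace s φ xbar l, u ≠ 0 → 0 < ⟪u, hessLagrangian φ₀ φ xbar l u⟫_ℝ

end NLP

end

/-!
Both implications rest on quadratic growth of the tilted problems with a modulus that does not depend
on the tilt.

*From SSOC to tilt stability.* Near `xbar`, every Karush–Kuhn–Tucker point of a slightly tilted
problem satisfies quadratic growth with a common modulus (`NLP.uniform_growth`); here SSOC enters
through Finsler's lemma (`exists_coercive_add_penalty`), and the penalty terms are absorbed by the
strictly positive multipliers. Minimizers of tilted problems are such points: LICQ provides
multipliers (`NLP.exists_multiplier_of_local_min`) and makes them close to the given one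
(`NLP.eventually_multiplier_near`). Adding the growth inequalities at two minimizers shows that the
minimizer is unique and Lipschitz in the tilt.

*From tilt stability to SSOC.* The conjugate of the objective has the argmin map `M` as its Lipschitz
gradient, and duality turns this into uniform quadratic growth at each `M y`
(`quadratic_growth_of_lipschitz_argmin`). Moreover every point near `xbar` with a small proximal
subgradient `v` is `M v` (`argmin_eq_of_lower_quadratic`). This applies to feasible points `x`
complementary to the multiplier `l`, with `v` the gradient of the Lagrangian. LICQ straightens the
active constraints (`exists_straightening`), and so gives pairs of such points whose differences
approximate any direction of the strong subspace: the base point moves off the constraints that are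
active with zero multiplier, which leaves room for both signs. Growth between the two points is the
second-order condition.
-/

section

open scoped Topology Gradient InnerProductSpace NNReal
open Filter Metric

/-! ### Dual families, straightening, Taylor expansion, coercivity -/

section General

variable {E : Type*} [NormedAddCommGroup E] [InnerProductSpace ℝ E] [FiniteDimensional ℝ E]
  {ι : Type*} [Fintype ι]

/-- A linearly independent subfamily of a finite family has a dual family; the dual vectors
outside the subfamily are orthogonal to it, so that sums may run over the whole index type. -/
theorem exists_dual_family (a : ι → E) (p : ι → Prop)
    (h : LinearIndependent ℝ (fun i : {i // p i} => a i)) :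
    ∃ b : ι → E, ∀ i, p i → (⟪a i, b i⟫_ℝ = 1 ∧ ∀ j, j ≠ i → ⟪a i, b j⟫_ℝ = 0) := by
  classical
  obtain ⟨g, hg⟩ := LinearMap.exists_leftInverse_of_injective
    (Fintype.linearCombination ℝ (fun i : {i // p i} => a i))
    (LinearMap.ker_eq_bot.2 (h.fintypeLinearCombination_injective))
  have hg' : ∀ i : {i // p i}, g (a i) = Pi.single i 1 := fun i => by
    have := LinearMap.congr_fun hg (Pi.single i 1)
    simpa [Fintype.linearCombination_apply_single] using this
  refine ⟨fun j => if hj : p j then (InnerProductSpace.toDual ℝ E).symm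
    (LinearMap.toContinuousLinearMap ((LinearMap.proj (⟨j, hj⟩ : {i // p i})).comp g)) else 0,
    fun i hi => ⟨?_, fun j hji => ?_⟩⟩
  · simp only [dif_pos hi]
    rw [real_inner_comm, InnerProductSpace.toDual_symm_apply]
    simp [hg' ⟨i, hi⟩]
  · by_cases hj : p j
    · simp only [dif_pos hj]
      rw [real_inner_comm, InnerProductSpace.toDual_symm_apply]
      simp [hg' ⟨i, hi⟩, hji]
    · simp [hj]

/-- Near a point where the gradients `a i`, `p i`, have a dual family, a change of variables tangent
to the identity turns the functions `g i`, `p i`, into affine ones. It is the local inverse of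
`x ↦ x + ∑ j, (g j x - g j x₀ - ⟪a j, x - x₀⟫) • b j`, whose derivative at `x₀` is the identity. -/
theorem exists_straightening (g : ι → E → ℝ) (a b : ι → E) (p : ι → Prop) (x₀ : E)
    (hg : ∀ i, HasStrictFDerivAt (g i) (innerSL ℝ (a i)) x₀)
    (hab : ∀ i, p i → (⟪a i, b i⟫_ℝ = 1 ∧ ∀ j, j ≠ i → ⟪a i, b j⟫_ℝ = 0)) :
    ∃ Ψ : E → E, Ψ x₀ = x₀ ∧ HasStrictFDerivAt Ψ (ContinuousLinearMap.id ℝ E) x₀ ∧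
      ∀ᶠ z in 𝓝 x₀, ∀ i, p i → g i (Ψ z) = g i x₀ + ⟪a i, z - x₀⟫_ℝ := by
  classical
  set Φ : E → E := fun x => x + ∑ j, (g j x - g j x₀ - innerSL ℝ (a j) (x - x₀)) • b j with hΦ
  have hΦ' : HasStrictFDerivAt Φ
      ((ContinuousLinearEquiv.refl ℝ E : E ≃L[ℝ] E) : E →L[ℝ] E) x₀ := by
    have h1 : ∀ j ∈ (Finset.univ : Finset ι), HasStrictFDerivAt
        (fun x => (g j x - g j x₀ - innerSL ℝ (a j) (x - x₀)) • b j)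
        (((innerSL ℝ (a j) : E →L[ℝ] ℝ) - innerSL ℝ (a j)).smulRight (b j)) x₀ := by
      intro j _
      refine HasStrictFDerivAt.smul_const ?_ (b j)
      exact ((hg j).sub_const _).sub
        ((innerSL ℝ (a j)).hasStrictFDerivAt.comp x₀ ((hasStrictFDerivAt_id x₀).sub_const x₀))
    have h2 := (hasStrictFDerivAt_id (𝕜 := ℝ) x₀).add (HasStrictFDerivAt.fun_sum h1)
    have h3 : ContinuousLinearMap.id ℝ E +
        ∑ i, ((innerSL ℝ (a i) : E →L[ℝ] ℝ) - innerSL ℝ (a i)).smulRight (b i) =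
        ((ContinuousLinearEquiv.refl ℝ E : E ≃L[ℝ] E) : E →L[ℝ] E) := by
      ext v; simp
    rw [← h3]
    exact h2
  have hfix : Φ x₀ = x₀ := by simp [hΦ]
  refine ⟨hΦ'.localInverse Φ _ x₀, ?_, ?_, ?_⟩
  · simpa only [hfix] using hΦ'.localInverse_apply_image
  · have := hΦ'.to_localInverse
    rw [hfix] at this
    exact this
  · have h := hΦ'.eventually_right_inverse
    rw [hfix] at h
    filter_upwards [h] with z hz i hi
    set x := hΦ'.localInverse Φ _ x₀ z
    have : ⟪a i, z - x₀⟫_ℝ = ⟪a i, Φ x - x₀⟫_ℝ := by rw [hz]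
    rw [this]
    have h3 : Φ x - x₀ = (x - x₀) + ∑ j, (g j x - g j x₀ - innerSL ℝ (a j) (x - x₀)) • b j := by
      simp only [hΦ]; abel
    rw [h3, inner_add_right, inner_sum, Finset.sum_eq_single i]
    · rw [inner_smul_right, (hab i hi).1]
      simp
    · intro j _ hji
      rw [inner_smul_right, (hab i hi).2 j hji, mul_zero]
    · simp

/-- Second-order Taylor expansion with a base point that may vary near `x₀`: the Hessian is taken at
`x₀` only, which strict differentiability of the gradient there allows. -/
theorem eventually_taylor_two {f : E → ℝ} {x₀ : E} {H : E →L[ℝ] E}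
    (hf : ∀ᶠ x in 𝓝 x₀, DifferentiableAt ℝ f x) (hH : HasStrictFDerivAt (∇ f) H x₀)
    {ε : ℝ} (hε : 0 < ε) :
    ∀ᶠ q : E × E in 𝓝 (x₀, x₀),
      |f q.1 - f q.2 - ⟪∇ f q.2, q.1 - q.2⟫_ℝ - ⟪q.1 - q.2, H (q.1 - q.2)⟫_ℝ / 2|
        ≤ ε * ‖q.1 - q.2‖ ^ 2 := by
  have h1 := hH.isLittleO.def hε
  rw [nhds_prod_eq] at h1
  obtain ⟨r, hr, hr'⟩ : ∃ r > 0, ∀ x ∈ ball x₀ r, DifferentiableAt ℝ f x ∧ ∀ x' ∈ ball x₀ r,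
      ‖∇ f x - ∇ f x' - H (x - x')‖ ≤ ε * ‖x - x'‖ := by
    obtain ⟨r₁, hr₁, h₁⟩ := Metric.eventually_nhds_iff_ball.1 hf
    rw [← nhds_prod_eq] at h1
    obtain ⟨r₂, hr₂, h₂⟩ := Metric.eventually_nhds_iff_ball.1 h1
    refine ⟨min r₁ r₂, lt_min hr₁ hr₂, fun x hx => ⟨h₁ x (ball_subset_ball (min_le_left _ _) hx),
      fun x' hx' => h₂ (x, x') ?_⟩⟩
    rw [← ball_prod_same]
    exact ⟨ball_subset_ball (min_le_right _ _) hx, ball_subset_ball (min_le_right _ _) hx'⟩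
  refine Metric.eventually_nhds_iff_ball.2 ⟨r, hr, ?_⟩
  rintro ⟨x, x'⟩ hq
  rw [← ball_prod_same] at hq
  obtain ⟨hx, hx'⟩ : x ∈ ball x₀ r ∧ x' ∈ ball x₀ r := hq
  dsimp only
  set w := x - x' with hw
  -- mean value inequality for the remainder along the segment from `x'` to `x`
  set q : ℝ → ℝ := fun t => f (x' + t • w) - t * ⟪∇ f x', w⟫_ℝ - t ^ 2 / 2 * ⟪w, H w⟫_ℝ with hq
  have hmem : ∀ t ∈ Set.Icc (0 : ℝ) 1, x' + t • w ∈ ball x₀ r := by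
    intro t ht
    have := (convex_ball x₀ r).add_smul_sub_mem hx' hx ht
    simpa [hw] using this
  have hder : ∀ t ∈ Set.Icc (0 : ℝ) 1, HasDerivWithinAt q
      (⟪∇ f (x' + t • w) - ∇ f x' - H (t • w), w⟫_ℝ) (Set.Icc 0 1) t := by
    intro t ht
    have h2 : HasDerivAt (fun t : ℝ => x' + t • w) w t := by
      simpa using ((hasDerivAt_id t).smul_const w).const_add x'
    have h3 := (hr' _ (hmem t ht)).1.hasGradientAt.hasFDerivAt.comp_hasDerivAt t h2
    have h4 := (h3.sub ((hasDerivAt_id t).mul_const ⟪∇ f x', w⟫_ℝ)).sub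
      ((((hasDerivAt_id t).pow 2).div_const 2).mul_const ⟪w, H w⟫_ℝ)
    refine (h4.congr_deriv ?_).hasDerivWithinAt
    clear_value w
    rw [InnerProductSpace.toDual_apply_apply, inner_sub_left, inner_sub_left, map_smul, inner_smul_left,
      real_inner_comm w (H w)]
    simp only [Nat.cast_ofNat, id_eq, conj_trivial]
    ring
  have hb : ∀ t ∈ Set.Icc (0 : ℝ) 1,
      ‖⟪∇ f (x' + t • w) - ∇ f x' - H (t • w), w⟫_ℝ‖ ≤ ε * ‖w‖ ^ 2 := by
    intro t ht
    refine (norm_inner_le_norm _ _).trans ?_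
    have h5 := (hr' _ (hmem t ht)).2 x' hx'
    rw [add_sub_cancel_left, norm_smul, Real.norm_of_nonneg ht.1] at h5
    calc _ ≤ (ε * (t * ‖w‖)) * ‖w‖ := by gcongr
      _ ≤ (ε * (1 * ‖w‖)) * ‖w‖ := by gcongr; exact ht.2
      _ = ε * ‖w‖ ^ 2 := by ring
  have h6 := (convex_Icc (0 : ℝ) 1).norm_image_sub_le_of_norm_hasDerivWithin_le hder hb
    (Set.left_mem_Icc.2 zero_le_one) (Set.right_mem_Icc.2 zero_le_one)
  simp only [hq, Real.norm_eq_abs] at h6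
  convert h6 using 1
  · congr 1
    simp [hw]; ring
  · simp

/-- Finsler's lemma: a quadratic form that is positive on the common kernel of finitely many
functionals becomes coercive after adding a large multiple of the sum of their squares. -/
theorem exists_coercive_add_penalty (H : E →L[ℝ] E) (a : ι → E) (p : ι → Prop)
    [DecidablePred p]
    (h : ∀ u, (∀ i, p i → ⟪a i, u⟫_ℝ = 0) → u ≠ 0 → 0 < ⟪u, H u⟫_ℝ) :
    ∃ c > 0, ∃ C : ℝ, 0 < C ∧ ∀ u,
      c * ‖u‖ ^ 2 ≤ ⟪u, H u⟫_ℝ + C * ∑ i, if p i then ⟪a i, u⟫_ℝ ^ 2 else 0 := by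
  set P : E → ℝ := fun u => ∑ i, if p i then ⟪a i, u⟫_ℝ ^ 2 else 0 with hP
  have hP0 : ∀ u, 0 ≤ P u := fun u => Finset.sum_nonneg fun i _ => by split_ifs <;> positivity
  have hPc : Continuous P := by
    refine continuous_finsetSum _ fun i _ => ?_
    split_ifs <;> fun_prop
  -- the same `k` serves as penalty `k + 1` and as coercivity constant `1 / (k + 1)`, so that the
  -- sets below increase with `k`
  have hcov : ∃ k : ℕ, sphere (0 : E) 1 ⊆
      {u | 1 / ((k : ℝ) + 1) < ⟪u, H u⟫_ℝ + ((k : ℝ) + 1) * P u} := by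
    refine (isCompact_sphere (0 : E) 1).elim_directed_cover _ (fun k => ?_) ?_ ?_
    · exact isOpen_lt continuous_const (by fun_prop)
    · intro u hu
      have hu0 : u ≠ 0 := by rintro rfl; simp at hu
      rw [Set.mem_iUnion]
      rcases (hP0 u).eq_or_lt with h0 | h0
      · have hq : 0 < ⟪u, H u⟫_ℝ := by
          refine h u (fun i hi => ?_) hu0
          have := (Finset.sum_eq_zero_iff_of_nonneg
            (fun i _ => by split_ifs <;> positivity)).1 h0.symm i (Finset.mem_univ i)
          simpa [hi] using this
        obtain ⟨k, hk⟩ := exists_nat_one_div_lt hq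
        exact ⟨k, by simpa [← h0] using hk⟩
      · obtain ⟨k, hk⟩ := exists_nat_gt ((1 - ⟪u, H u⟫_ℝ) / P u)
        refine ⟨k, ?_⟩
        rw [div_lt_iff₀ h0] at hk
        have : 1 / ((k : ℝ) + 1) ≤ 1 := by
          rw [div_le_one (by positivity)]; linarith [(Nat.cast_nonneg k : (0 : ℝ) ≤ k)]
        simp only [Set.mem_ofPred_eq]
        linarith
    · refine Monotone.directed_le fun k l hkl u hu => ?_
      have hkl' : (k : ℝ) ≤ l := by exact_mod_cast hkl
      simp only [Set.mem_ofPred_eq] at hu ⊢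
      have h1 : 1 / ((l : ℝ) + 1) ≤ 1 / ((k : ℝ) + 1) := by gcongr
      have h2 := mul_le_mul_of_nonneg_right (add_le_add_left hkl' 1) (hP0 u)
      linarith
  obtain ⟨k, hk⟩ := hcov
  refine ⟨1 / ((k : ℝ) + 1), by positivity, (k : ℝ) + 1, by positivity, fun u => ?_⟩
  rcases eq_or_ne u 0 with rfl | hu
  · simp
  have hn : 0 < ‖u‖ := norm_pos_iff.2 hu
  have h1 := hk (show ‖u‖⁻¹ • u ∈ sphere (0 : E) 1 by
    simp [norm_smul, hn.ne'])
  have h2 : P (‖u‖⁻¹ • u) = (‖u‖⁻¹) ^ 2 * P u := by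
    simp only [hP, inner_smul_right, Finset.mul_sum, mul_pow, mul_ite, mul_zero]
  simp only [Set.mem_ofPred_eq, h2, map_smul, inner_smul_left, inner_smul_right] at h1
  have h3 := mul_le_mul_of_nonneg_right h1.le (sq_nonneg ‖u‖)
  refine h3.trans (le_of_eq ?_)
  simp only [conj_trivial, hP]
  field_simp

end General

/-! ### Quadratic growth and attainment from Lipschitz minimizers -/

section TiltedMinimizers

variable {E : Type*} [NormedAddCommGroup E] [InnerProductSpace ℝ E]
  {C : Set E} {f : E → ℝ} {M : E → E} {K δ : ℝ}

/-- The value at `y` of the conjugate `y ↦ sup_{x ∈ C} (⟪y, x⟫ - f x)`, written through a selection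
`M` of maximizers. It is meaningful only where `M y` does maximize. -/
noncomputable def tiltConj (f : E → ℝ) (M : E → E) (y : E) : ℝ := ⟪y, M y⟫_ℝ - f (M y)

/-- Subgradient inequality: `M y` is a subgradient of the conjugate at `y`. -/
theorem tiltConj_add_inner_le {y y' : E} (hy : M y ∈ C)
    (hmin' : ∀ z ∈ C, f (M y') - ⟪y', M y'⟫_ℝ ≤ f z - ⟪y', z⟫_ℝ) :
    tiltConj f M y + ⟪y' - y, M y⟫_ℝ ≤ tiltConj f M y' := by
  have := hmin' _ hy
  rw [tiltConj, tiltConj, inner_sub_left]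
  linarith

/-- Descent inequality: the conjugate has the `K`-Lipschitz gradient `M`. The constant `K` in place
of the sharp `K / 2` comes from the subgradient inequality at `y'` and avoids integration. -/
theorem tiltConj_le (hMC : ∀ y ∈ closedBall (0 : E) δ, M y ∈ C)
    (hmin : ∀ y ∈ closedBall (0 : E) δ, ∀ z ∈ C, f (M y) - ⟪y, M y⟫_ℝ ≤ f z - ⟪y, z⟫_ℝ)
    (hLip : ∀ y ∈ closedBall (0 : E) δ, ∀ y' ∈ closedBall (0 : E) δ,
      ‖M y - M y'‖ ≤ K * ‖y - y'‖)
    {y y' : E} (hy : y ∈ closedBall (0 : E) δ) (hy' : y' ∈ closedBall (0 : E) δ) :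
    tiltConj f M y' ≤ tiltConj f M y + ⟪y' - y, M y⟫_ℝ + K * ‖y' - y‖ ^ 2 := by
  have h1 := tiltConj_add_inner_le (hMC y' hy') (hmin y hy)
  have h2 : ⟪y' - y, M y' - M y⟫_ℝ ≤ K * ‖y' - y‖ ^ 2 := by
    calc _ ≤ ‖y' - y‖ * ‖M y' - M y‖ := real_inner_le_norm _ _
      _ ≤ ‖y' - y‖ * (K * ‖y' - y‖) := by gcongr; exact hLip _ hy' _ hy
      _ = _ := by ring
  rw [inner_sub_right] at h2
  have h3 : ⟪y - y', M y'⟫_ℝ = - ⟪y' - y, M y'⟫_ℝ := by rw [← inner_neg_left, neg_sub]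
  linarith

/-- Lipschitz dependence of the minimizers on the tilt forces quadratic growth of the tilted function
at each of them: the tilt `y' = y + (x - M y) / (2K)` in the inequality
`f x ≥ ⟪y', x⟫ - tiltConj f M y'` gives the bound. -/
theorem quadratic_growth_of_lipschitz_argmin (hK : 0 < K)
    (hMC : ∀ y ∈ closedBall (0 : E) δ, M y ∈ C)
    (hmin : ∀ y ∈ closedBall (0 : E) δ, ∀ z ∈ C, f (M y) - ⟪y, M y⟫_ℝ ≤ f z - ⟪y, z⟫_ℝ)
    (hLip : ∀ y ∈ closedBall (0 : E) δ, ∀ y' ∈ closedBall (0 : E) δ,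
      ‖M y - M y'‖ ≤ K * ‖y - y'‖)
    {y x : E} (hx : x ∈ C) (hyx : ‖y‖ + ‖x - M y‖ / (2 * K) ≤ δ) :
    f (M y) + ⟪y, x - M y⟫_ℝ + ‖x - M y‖ ^ 2 / (4 * K) ≤ f x := by
  set w := x - M y with hw
  have hy : y ∈ closedBall (0 : E) δ := by
    rw [mem_closedBall_zero_iff]
    have : 0 ≤ ‖w‖ / (2 * K) := by positivity
    linarith
  set y' := y + (1 / (2 * K)) • w with hy'
  have hmem : y' ∈ closedBall (0 : E) δ := by
    rw [mem_closedBall_zero_iff]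
    refine (norm_add_le _ _).trans ?_
    rw [norm_smul, Real.norm_of_nonneg (by positivity), one_div_mul_eq_div]
    exact hyx
  have h1 := tiltConj_le hMC hmin hLip hy hmem
  have h2 := hmin y' hmem x hx
  have h3 : y' - y = (1 / (2 * K)) • w := by simp [hy']
  have h4 : x = M y + w := by simp [hw]
  have h5 : ⟪y', x⟫_ℝ = ⟪y, M y⟫_ℝ + ⟪y, w⟫_ℝ + 1 / (2 * K) * ⟪w, M y⟫_ℝ
      + 1 / (2 * K) * ‖w‖ ^ 2 := by
    rw [h4, hy', inner_add_left, inner_add_right, inner_add_right, inner_smul_left,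
      inner_smul_left, real_inner_self_eq_norm_sq]
    simp; ring
  rw [h3, norm_smul, inner_smul_left, Real.norm_of_nonneg (by positivity)] at h1
  simp only [tiltConj, conj_trivial] at h1
  have h6 : K * (1 / (2 * K) * ‖w‖) ^ 2 = ‖w‖ ^ 2 / (4 * K) := by field_simp; ring
  have h7 : 1 / (2 * K) * ‖w‖ ^ 2 = ‖w‖ ^ 2 / (4 * K) + ‖w‖ ^ 2 / (4 * K) := by field_simp; ring
  linarith

/-- A point `x₀` at which `f` has the proximal subgradient `v` is the minimizer for the tilt `v`, when
`v` is small and `f x₀` is close to the least value. The tilt `y` with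
`y + ρ • M y = v + ρ • x₀` is found by maximizing the strongly concave function
`⟪y, x₀ + v / ρ⟫ - tiltConj f M y - ‖y‖² / (2ρ)`; for `ρ > c` the lower quadratic bound then
forces `M y = x₀`, hence `y = v`. -/
theorem argmin_eq_of_lower_quadratic [FiniteDimensional ℝ E] {R ρ c : ℝ} (hδ : 0 < δ) (hρ : 0 < ρ)
    (hMC : ∀ y ∈ closedBall (0 : E) δ, M y ∈ C)
    (hR : ∀ z ∈ C, ‖z‖ ≤ R)
    (hmin : ∀ y ∈ closedBall (0 : E) δ, ∀ z ∈ C, f (M y) - ⟪y, M y⟫_ℝ ≤ f z - ⟪y, z⟫_ℝ)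
    (hLip : ∀ y ∈ closedBall (0 : E) δ, ∀ y' ∈ closedBall (0 : E) δ,
      ‖M y - M y'‖ ≤ K * ‖y - y'‖)
    {x₀ v : E} (hx₀ : x₀ ∈ C) (hcρ : c < ρ)
    (hlow : ∀ y ∈ closedBall (0 : E) δ,
      f x₀ + ⟪v, M y - x₀⟫_ℝ - c * ‖M y - x₀‖ ^ 2 ≤ f (M y))
    (hsmall : 2 * δ * ‖v‖ + 2 * ρ * (f x₀ - f (M 0)) < δ ^ 2) :
    ‖v‖ < δ ∧ M v = x₀ := by
  set p : E := x₀ + (1 / ρ) • v with hp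
  set θ : E → ℝ := fun y => ⟪y, p⟫_ℝ - tiltConj f M y - ‖y‖ ^ 2 / (2 * ρ) with hθ
  have h0 : (0 : E) ∈ closedBall (0 : E) δ := by simp [hδ.le]
  have hcont : ContinuousOn (tiltConj f M) (closedBall (0 : E) δ) := by
    have key : ∀ y ∈ closedBall (0 : E) δ, ∀ y' ∈ closedBall (0 : E) δ,
        tiltConj f M y ≤ tiltConj f M y' + R * ‖y - y'‖ := by
      intro y hy y' hy'
      have h1 := tiltConj_add_inner_le (hMC y hy) (hmin y' hy')
      have h2 : ⟪y - y', M y⟫_ℝ ≤ R * ‖y - y'‖ := by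
        calc _ ≤ ‖y - y'‖ * ‖M y‖ := real_inner_le_norm _ _
          _ ≤ ‖y - y'‖ * R := by gcongr; exact hR _ (hMC y hy)
          _ = _ := by ring
      have h3 : ⟪y' - y, M y⟫_ℝ = - ⟪y - y', M y⟫_ℝ := by rw [← inner_neg_left, neg_sub]
      linarith
    have hR0 : 0 ≤ R := (norm_nonneg _).trans (hR _ hx₀)
    refine LipschitzOnWith.continuousOn (K := ⟨R, hR0⟩) (LipschitzOnWith.of_dist_le_mul ?_)
    intro y hy y' hy'
    rw [Real.dist_eq, dist_eq_norm, abs_sub_le_iff]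
    have h1 := key y hy y' hy'
    have h2 := key y' hy' y hy
    rw [norm_sub_rev] at h2
    change tiltConj f M y - tiltConj f M y' ≤ R * ‖y - y'‖ ∧
      tiltConj f M y' - tiltConj f M y ≤ R * ‖y - y'‖
    constructor <;> linarith
  have hθc : ContinuousOn θ (closedBall (0 : E) δ) :=
    ((by fun_prop : Continuous fun y : E => ⟪y, p⟫_ℝ).continuousOn.sub hcont).sub
      (by fun_prop : Continuous fun y : E => ‖y‖ ^ 2 / (2 * ρ)).continuousOn
  obtain ⟨y, hy, hmax⟩ := (isCompact_closedBall (0 : E) δ).exists_isMaxOn ⟨0, h0⟩ hθc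
  -- the maximizer is interior
  have hpy : ⟪y, p⟫_ℝ = ⟪y, x₀⟫_ℝ + ⟪y, v⟫_ℝ / ρ := by
    rw [hp, inner_add_right, inner_smul_right]; ring
  have hyδ : ‖y‖ < δ := by
    refine lt_of_le_of_ne (mem_closedBall_zero_iff.1 hy) fun hne => ?_
    have h1 : θ 0 ≤ θ y := hmax h0
    have h2 := hmin y hy x₀ hx₀
    have h3 : ⟪y, v⟫_ℝ ≤ δ * ‖v‖ := by rw [← hne]; exact real_inner_le_norm _ _
    simp only [hθ, tiltConj, inner_zero_left, norm_zero, hpy, hne] at h1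
    have h4 : f (M 0) ≤ f x₀ + ⟪y, v⟫_ℝ / ρ - δ ^ 2 / (2 * ρ) := by
      norm_num at h1; linarith
    have h5 := mul_le_mul_of_nonneg_left h4 (by positivity : 0 ≤ 2 * ρ)
    have h6 : 2 * ρ * (f x₀ + ⟪y, v⟫_ℝ / ρ - δ ^ 2 / (2 * ρ))
        = 2 * ρ * f x₀ + 2 * ⟪y, v⟫_ℝ - δ ^ 2 := by field_simp
    linarith
  -- first-order condition
  set e : E := p - M y - (1 / ρ) • y with he
  clear_value e
  have he0 : e = 0 := by
    by_contra hne
    have hpos : 0 < ‖e‖ := norm_pos_iff.2 hne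
    obtain ⟨D, hD, hDK⟩ : ∃ D : ℝ, 0 < D ∧ K + 1 / (2 * ρ) ≤ D :=
      ⟨max 1 (K + 1 / (2 * ρ)), by positivity, le_max_right _ _⟩
    obtain ⟨τ, hτ, hτ1, hτ2⟩ : ∃ τ : ℝ, 0 < τ ∧ τ * ‖e‖ ≤ δ - ‖y‖ ∧ τ * D < 1 := by
      refine ⟨min ((δ - ‖y‖) / ‖e‖) (1 / (2 * D)), lt_min (div_pos (by linarith) hpos)
        (by positivity), ?_, ?_⟩
      · rw [← le_div_iff₀ hpos]; exact min_le_left _ _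
      · calc _ ≤ 1 / (2 * D) * D := by gcongr; exact min_le_right _ _
          _ < 1 := by field_simp; norm_num
    have hmem : y + τ • e ∈ closedBall (0 : E) δ := by
      rw [mem_closedBall_zero_iff]
      refine (norm_add_le _ _).trans ?_
      rw [norm_smul, Real.norm_of_nonneg hτ.le]; linarith
    have h1 : θ (y + τ • e) ≤ θ y := hmax hmem
    have h2 := tiltConj_le hMC hmin hLip hy hmem
    have h3 : ‖y + τ • e‖ ^ 2 = ‖y‖ ^ 2 + 2 * τ * ⟪y, e⟫_ℝ + τ ^ 2 * ‖e‖ ^ 2 := by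
      rw [norm_add_sq_real, inner_smul_right, norm_smul, Real.norm_of_nonneg hτ.le]; ring
    have h4 : ⟪e, p⟫_ℝ - ⟪e, M y⟫_ℝ - ⟪y, e⟫_ℝ / ρ = ‖e‖ ^ 2 := by
      have h : ⟪e, e⟫_ℝ = ⟪p - M y - (1 / ρ) • y, e⟫_ℝ := congrArg (fun z => ⟪z, e⟫_ℝ) he
      rw [inner_sub_left, inner_sub_left, inner_smul_left, real_inner_comm e p,
        real_inner_comm e (M y), real_inner_self_eq_norm_sq, conj_trivial] at h
      rw [h]; ring
    rw [add_sub_cancel_left, norm_smul, Real.norm_of_nonneg hτ.le, inner_smul_left] at h2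
    simp only [hθ, h3, inner_add_left, inner_smul_left, conj_trivial] at h1 h2
    have h5 : (‖y‖ ^ 2 + 2 * τ * ⟪y, e⟫_ℝ + τ ^ 2 * ‖e‖ ^ 2) / (2 * ρ)
        = ‖y‖ ^ 2 / (2 * ρ) + τ * (⟪y, e⟫_ℝ / ρ) + τ ^ 2 * ‖e‖ ^ 2 * (1 / (2 * ρ)) := by
      field_simp
    rw [h5] at h1
    have h6 : τ * ‖e‖ ^ 2 ≤ τ ^ 2 * ‖e‖ ^ 2 * (K + 1 / (2 * ρ)) := by
      linear_combination h1 + h2 - τ * h4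
    have h7 : τ ^ 2 * ‖e‖ ^ 2 * (K + 1 / (2 * ρ)) ≤ τ ^ 2 * ‖e‖ ^ 2 * D := by gcongr
    have h8 : τ * ‖e‖ ^ 2 * 1 ≤ τ * ‖e‖ ^ 2 * (τ * D) := by linarith
    have := le_of_mul_le_mul_left h8 (by positivity)
    linarith
  -- hence `y = v + ρ (x₀ - M y)`
  have hyv : y = v + ρ • (x₀ - M y) := by
    have h1 : ρ • e = 0 := by rw [he0, smul_zero]
    rw [he, hp, smul_sub, smul_smul, mul_one_div_cancel hρ.ne', one_smul, sub_eq_zero] at h1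
    calc y = ρ • (x₀ + (1 / ρ) • v - M y) := h1.symm
      _ = v + ρ • (x₀ - M y) := by
        rw [add_sub_right_comm, smul_add, smul_smul, mul_one_div_cancel hρ.ne', one_smul, add_comm]
  have hMy : M y = x₀ := by
    have h1 := hmin y hy x₀ hx₀
    have h2 := hlow y hy
    have h3 : ⟪y, x₀ - M y⟫_ℝ = ⟪v, x₀ - M y⟫_ℝ + ρ * ‖M y - x₀‖ ^ 2 := by
      have h := congrArg (fun z => ⟪z, x₀ - M y⟫_ℝ) hyv
      simp only [inner_add_left, inner_smul_left, real_inner_self_eq_norm_sq, conj_trivial] at h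
      rw [h, norm_sub_rev]
    have h4 : ⟪v, M y - x₀⟫_ℝ = - ⟪v, x₀ - M y⟫_ℝ := by rw [← inner_neg_right, neg_sub]
    rw [inner_sub_right] at h3
    have h5 : (ρ - c) * ‖M y - x₀‖ ^ 2 ≤ 0 := by linarith
    have h6 : ‖M y - x₀‖ ^ 2 ≤ 0 := by
      by_contra hcon
      push Not at hcon
      linarith [mul_pos (sub_pos.2 hcρ) hcon]
    have h7 : ‖M y - x₀‖ = 0 := by
      have := sq_nonneg ‖M y - x₀‖
      exact pow_eq_zero_iff (two_ne_zero) |>.1 (le_antisymm h6 this)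
    exact sub_eq_zero.1 (norm_eq_zero.1 h7)
  have hyv' : y = v := by rw [hyv, hMy]; simp
  rw [hyv'] at hyδ hMy
  exact ⟨hyδ, hMy⟩

end TiltedMinimizers

/-! ### Consequences of strict differentiability of the gradient -/

namespace SmoothWithStrictDeriv

variable {n : ℕ} {f : Rn n → ℝ} {x : Rn n}

theorem eventually_hasStrictFDerivAt (hf : SmoothWithStrictDeriv f x) :
    ∀ᶠ z in 𝓝 x, HasStrictFDerivAt f (innerSL ℝ (∇ f z)) z := by
  filter_upwards [hf.1.eventually (by simp)] with z hz
  have h1 := hz.hasStrictFDerivAt one_ne_zero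
  have h2 := (hz.differentiableAt one_ne_zero).hasGradientAt.hasFDerivAt.unique h1.hasFDerivAt
  rw [← h2] at h1
  exact h1

theorem hasStrictFDerivAt (hf : SmoothWithStrictDeriv f x) :
    HasStrictFDerivAt f (innerSL ℝ (∇ f x)) x :=
  hf.eventually_hasStrictFDerivAt.self_of_nhds

theorem eventually_hasGradientAt (hf : SmoothWithStrictDeriv f x) :
    ∀ᶠ z in 𝓝 x, HasGradientAt f (∇ f z) z :=
  hf.eventually_hasStrictFDerivAt.mono fun _ hz => hz.differentiableAt.hasGradientAt

theorem continuousAt (hf : SmoothWithStrictDeriv f x) : ContinuousAt f x :=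
  hf.hasStrictFDerivAt.continuousAt

theorem continuousAt_gradient (hf : SmoothWithStrictDeriv f x) : ContinuousAt (∇ f) x :=
  hf.2.choose_spec.continuousAt

theorem eventually_taylor (hf : SmoothWithStrictDeriv f x) {ε : ℝ} (hε : 0 < ε) :
    ∀ᶠ q : Rn n × Rn n in 𝓝 (x, x),
      |f q.1 - f q.2 - ⟪∇ f q.2, q.1 - q.2⟫_ℝ -
        ⟪q.1 - q.2, fderiv ℝ (∇ f) x (q.1 - q.2)⟫_ℝ / 2| ≤ ε * ‖q.1 - q.2‖ ^ 2 := by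
  obtain ⟨H, hH⟩ := hf.2
  rw [hH.hasFDerivAt.fderiv]
  exact eventually_taylor_two
    (hf.eventually_hasStrictFDerivAt.mono fun _ hz => hz.differentiableAt) hH hε

/-- The remainder of the first-order expansion is quadratic, uniformly in the base point. -/
theorem exists_eventually_quadratic_bound (hf : SmoothWithStrictDeriv f x) :
    ∃ B : ℝ, 0 ≤ B ∧ ∀ᶠ q : Rn n × Rn n in 𝓝 (x, x),
      |f q.1 - f q.2 - ⟪∇ f q.2, q.1 - q.2⟫_ℝ| ≤ B * ‖q.1 - q.2‖ ^ 2 := by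
  refine ⟨1 + ‖fderiv ℝ (∇ f) x‖, by positivity, ?_⟩
  filter_upwards [hf.eventually_taylor one_pos] with q hq
  set w := q.1 - q.2
  have h1 : |⟪w, fderiv ℝ (∇ f) x w⟫_ℝ| ≤ ‖fderiv ℝ (∇ f) x‖ * ‖w‖ ^ 2 := by
    refine (abs_real_inner_le_norm _ _).trans ?_
    calc ‖w‖ * ‖fderiv ℝ (∇ f) x w‖ ≤ ‖w‖ * (‖fderiv ℝ (∇ f) x‖ * ‖w‖) := by
          gcongr; exact ContinuousLinearMap.le_opNorm _ _
      _ = _ := by ring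
  rw [abs_le] at *
  have h2 : 0 ≤ ‖fderiv ℝ (∇ f) x‖ * ‖w‖ ^ 2 := by positivity
  constructor <;> linarith

end SmoothWithStrictDeriv

/-! ### Karush–Kuhn–Tucker multipliers -/

namespace NLP

variable {n m s : ℕ} {φ₀ : Rn n → ℝ} {φ : Fin m → Rn n → ℝ} {xbar : Rn n}

/-- Straightened rays in a linearized feasible direction are feasible for small `t > 0`, and the
active constraints are exactly linear along them. -/
theorem eventually_arc_feasible {x : Rn n} {Ψ : Rn n → Rn n}
    (hφ : ∀ i, ContinuousAt (φ i) x) (hx : x ∈ feasibleSet s φ) (hΨx : Ψ x = x)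
    (hΨ : ContinuousAt Ψ x)
    (hΨφ : ∀ᶠ z in 𝓝 x, ∀ i, φ i x = 0 → φ i (Ψ z) = φ i x + ⟪∇ (φ i) x, z - x⟫_ℝ)
    {d : Rn n} (hd : ∀ i, φ i x = 0 → i.val < s → ⟪∇ (φ i) x, d⟫_ℝ ≤ 0)
    (hd' : ∀ i : Fin m, s ≤ i.val → ⟪∇ (φ i) x, d⟫_ℝ = 0) :
    ∀ᶠ t in 𝓝[>] (0 : ℝ), Ψ (x + t • d) ∈ feasibleSet s φ ∧
      ∀ i, φ i x = 0 → φ i (Ψ (x + t • d)) = t * ⟪∇ (φ i) x, d⟫_ℝ := by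
  have hlt : Tendsto (fun t : ℝ => x + t • d) (𝓝 0) (𝓝 x) := by
    have : Continuous fun t : ℝ => x + t • d := by fun_prop
    simpa using this.tendsto 0
  have hct : Tendsto (fun t : ℝ => Ψ (x + t • d)) (𝓝 0) (𝓝 x) := by
    have := hΨ.tendsto.comp hlt
    rwa [hΨx] at this
  have h1 : ∀ᶠ t in 𝓝[>] (0 : ℝ), ∀ i, φ i x < 0 → φ i (Ψ (x + t • d)) < 0 := by
    refine (eventually_all.2 fun i => ?_).filter_mono nhdsWithin_le_nhds
    by_cases hi : φ i x < 0
    · filter_upwards [((hφ i).tendsto.comp hct).eventually (gt_mem_nhds hi)] with t ht _ using ht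
    · exact Eventually.of_forall fun t h => absurd h hi
  filter_upwards [h1, self_mem_nhdsWithin, (hlt.eventually hΨφ).filter_mono nhdsWithin_le_nhds]
    with t ht1 (ht0 : 0 < t) ht2
  have h3 : ∀ i, φ i x = 0 → φ i (Ψ (x + t • d)) = t * ⟪∇ (φ i) x, d⟫_ℝ := fun i h => by
    rw [ht2 i h, h, add_sub_cancel_left, inner_smul_right, zero_add]
  refine ⟨fun i => ⟨fun hi => ?_, fun hi => ?_⟩, h3⟩
  · rcases ((hx i).1 hi).lt_or_eq with h | h
    · exact (ht1 i h).le
    · rw [h3 i h]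
      exact mul_nonpos_of_nonneg_of_nonpos ht0.le (hd i h hi)
  · rw [h3 i ((hx i).2 hi), hd' i hi, mul_zero]

/-- Karush–Kuhn–Tucker conditions under LICQ. Along straightened rays the objective has nonnegative
slope, so `v` vanishes on the common kernel of the active gradients and is nonnegative on the
negatives of the dual vectors of the active inequalities; the multipliers are read off from the
dual family. -/
theorem exists_multiplier_of_local_min {f : Rn n → ℝ} {x v : Rn n} (hf : HasGradientAt f v x)
    (hφ : ∀ i, HasStrictFDerivAt (φ i) (innerSL ℝ (∇ (φ i) x)) x) (hlicq : LICQ φ x)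
    (hx : x ∈ feasibleSet s φ) (hmin : ∀ᶠ z in 𝓝 x, z ∈ feasibleSet s φ → f x ≤ f z) :
    ∃ l : Fin m → ℝ, (∀ i : Fin m, i.val < s → 0 ≤ l i) ∧ (∀ i, φ i x ≠ 0 → l i = 0) ∧
      v + ∑ i, l i • ∇ (φ i) x = 0 := by
  obtain ⟨b, hb⟩ := exists_dual_family (fun i => ∇ (φ i) x) (fun i => φ i x = 0) hlicq
  obtain ⟨Ψ, hΨx, hΨ, hΨφ⟩ := exists_straightening φ _ b _ x hφ hb
  have key : ∀ d : Rn n, (∀ i, φ i x = 0 → i.val < s → ⟪∇ (φ i) x, d⟫_ℝ ≤ 0) →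
      (∀ i : Fin m, s ≤ i.val → ⟪∇ (φ i) x, d⟫_ℝ = 0) → 0 ≤ ⟪v, d⟫_ℝ := by
    intro d hd1 hd2
    have hline : HasDerivAt (fun t : ℝ => x + t • d) d 0 := by
      simpa using ((hasDerivAt_id (0 : ℝ)).smul_const d).const_add x
    have hx0 : x + (0 : ℝ) • d = x := by simp
    have hc : HasDerivAt (fun t : ℝ => Ψ (x + t • d)) d 0 := by
      have h : HasFDerivAt Ψ (ContinuousLinearMap.id ℝ (Rn n)) (x + (0 : ℝ) • d) := by
        rw [hx0]; exact hΨ.hasFDerivAt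
      exact h.comp_hasDerivAt (0 : ℝ) hline
    have hc0 : Ψ (x + (0 : ℝ) • d) = x := by rw [hx0, hΨx]
    have hq : HasDerivAt (fun t : ℝ => f (Ψ (x + t • d))) ⟪v, d⟫_ℝ 0 := by
      have h : HasFDerivAt f (InnerProductSpace.toDual ℝ (Rn n) v) (Ψ (x + (0 : ℝ) • d)) := by
        rw [hc0]; exact hf.hasFDerivAt
      exact h.comp_hasDerivAt (0 : ℝ) hc
    have hct : Tendsto (fun t : ℝ => Ψ (x + t • d)) (𝓝 0) (𝓝 x) := by
      have := hc.continuousAt.tendsto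
      rwa [hc0] at this
    have hfeas := eventually_arc_feasible (fun i => (hφ i).continuousAt) hx hΨx hΨ.continuousAt hΨφ
      hd1 hd2
    refine ge_of_tendsto hq.tendsto_slope_zero_right ?_
    filter_upwards [hfeas, (hct.eventually hmin).filter_mono nhdsWithin_le_nhds,
      self_mem_nhdsWithin] with t ⟨h1, _⟩ h2 (ht0 : 0 < t)
    rw [zero_add, hc0, smul_eq_mul]
    exact mul_nonneg (inv_nonneg.2 ht0.le) (sub_nonneg.2 (h2 h1))
  have hker : ∀ d : Rn n, (∀ i, φ i x = 0 → ⟪∇ (φ i) x, d⟫_ℝ = 0) → ⟪v, d⟫_ℝ = 0 := by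
    intro d hd
    have h1 := key d (fun i hi _ => (hd i hi).le) (fun i hi => hd i ((hx i).2 hi))
    have h2 := key (-d) (fun i hi _ => by rw [inner_neg_right, hd i hi, neg_zero])
      (fun i hi => by rw [inner_neg_right, hd i ((hx i).2 hi), neg_zero])
    rw [inner_neg_right] at h2
    linarith
  classical
  refine ⟨fun i => if φ i x = 0 then -⟪v, b i⟫_ℝ else 0, fun i hi => ?_, fun i hi => if_neg hi, ?_⟩
  · dsimp only
    split_ifs with h
    · rw [← inner_neg_right]
      refine key _ (fun j hj _ => ?_) (fun j hj => ?_)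
      · rw [inner_neg_right]
        rcases eq_or_ne i j with rfl | hij
        · rw [(hb i hj).1]; norm_num
        · rw [(hb j hj).2 i hij, neg_zero]
      · have hij : i ≠ j := by rintro rfl; omega
        rw [inner_neg_right, (hb j ((hx j).2 hj)).2 i hij, neg_zero]
    · exact le_rfl
  · refine ext_inner_right ℝ fun d => ?_
    have h1 := hker (d - ∑ i, (if φ i x = 0 then ⟪∇ (φ i) x, d⟫_ℝ else 0) • b i) (fun j hj => by
      rw [inner_sub_right, inner_sum, Finset.sum_eq_single j, if_pos hj, inner_smul_right,
        (hb j hj).1, mul_one, sub_self]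
      · intro i _ hij
        rw [inner_smul_right, (hb j hj).2 i hij, mul_zero]
      · simp)
    rw [inner_sub_right, sub_eq_zero] at h1
    rw [inner_add_left, h1, inner_sum, sum_inner, ← Finset.sum_add_distrib, inner_zero_left]
    refine Finset.sum_eq_zero fun i _ => ?_
    rw [inner_smul_right, inner_smul_left, conj_trivial]
    dsimp only
    split_ifs <;> ring

theorem eventually_licq (hφ : ∀ i, SmoothWithStrictDeriv (φ i) xbar) (hlicq : LICQ φ xbar) :
    ∀ᶠ x in 𝓝 xbar, LICQ φ x := by
  have hopen := isOpen_setOfPred_linearIndependent (𝕜 := ℝ) (E := Rn n)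
    (ι := {i : Fin m // φ i xbar = 0})
  have hcont : ContinuousAt (fun x => fun i : {i : Fin m // φ i xbar = 0} => ∇ (φ i.val) x) xbar :=
    continuousAt_pi.2 fun i => (hφ i).continuousAt_gradient
  have h1 : ∀ᶠ x in 𝓝 xbar, ∀ i, φ i xbar ≠ 0 → φ i x ≠ 0 := by
    refine eventually_all.2 fun i => ?_
    by_cases hi : φ i xbar = 0
    · exact Eventually.of_forall fun x h => absurd hi h
    · filter_upwards [(hφ i).continuousAt.eventually_ne hi] with x hx _ using hx
  filter_upwards [hcont.eventually (hopen.mem_nhds hlicq), h1] with x hx1 hx2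
  refine LinearIndependent.comp hx1 (fun i : {i : Fin m // φ i x = 0} =>
    ⟨i.1, by_contra fun h => hx2 _ h i.2⟩) ?_
  intro i j hij
  exact Subtype.ext (congrArg (fun k : {i : Fin m // φ i xbar = 0} => k.1) hij)

/-- Under LICQ, multipliers of the problem tilted by `q.2` at the point `q.1` converge to `l` as
`q → (xbar, 0)`. Pairing the multiplier equation with the dual family at `xbar` gives
`|l' j - l j| ≤ δ (1 + ∑ |l' i|)` with `δ` small; summing over `j` first bounds `∑ |l' i|`. -/
theorem eventually_multiplier_near (hφ₀ : SmoothWithStrictDeriv φ₀ xbar)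
    (hφ : ∀ i, SmoothWithStrictDeriv (φ i) xbar) (hlicq : LICQ φ xbar) {l : Fin m → ℝ}
    (hl : IsMultiplier s φ₀ φ xbar l) {ε : ℝ} (hε : 0 < ε) :
    ∀ᶠ q : Rn n × Rn n in 𝓝 (xbar, 0), ∀ l' : Fin m → ℝ, (∀ i, φ i xbar ≠ 0 → l' i = 0) →
      ∇ φ₀ q.1 - q.2 + ∑ i, l' i • ∇ (φ i) q.1 = 0 → ∀ i, |l' i - l i| ≤ ε := by
  obtain ⟨b, hb⟩ := exists_dual_family (fun i => ∇ (φ i) xbar) (fun i => φ i xbar = 0) hlicq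
  set S := ∑ i, |l i| with hS
  have hS0 : 0 ≤ S := Finset.sum_nonneg fun i _ => abs_nonneg _
  obtain ⟨δ, hδ, hδ1, hδ2⟩ : ∃ δ > 0, δ * (2 + 2 * S) ≤ ε ∧ (m : ℝ) * δ ≤ 1 / 2 := by
    refine ⟨min (ε / (2 + 2 * S)) (1 / (2 * ((m : ℝ) + 1))), by positivity, ?_, ?_⟩
    · rw [← le_div_iff₀ (by positivity)]; exact min_le_left _ _
    · calc (m : ℝ) * _ ≤ (m + 1) * (1 / (2 * ((m : ℝ) + 1))) := by
            gcongr
            · linarith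
            · exact min_le_right _ _
        _ = 1 / 2 := by field_simp
  have hfst : Tendsto (fun q : Rn n × Rn n => q.1) (𝓝 (xbar, 0)) (𝓝 xbar) :=
    continuous_fst.tendsto _
  have hsnd : Tendsto (fun q : Rn n × Rn n => q.2) (𝓝 (xbar, 0)) (𝓝 0) := continuous_snd.tendsto _
  have h1 : ∀ᶠ q : Rn n × Rn n in 𝓝 (xbar, 0), ∀ j, |⟪∇ φ₀ q.1 - q.2 - ∇ φ₀ xbar, b j⟫_ℝ| ≤ δ := by
    refine eventually_all.2 fun j => ?_
    have : Tendsto (fun q : Rn n × Rn n => |⟪∇ φ₀ q.1 - q.2 - ∇ φ₀ xbar, b j⟫_ℝ|) (𝓝 (xbar, 0))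
        (𝓝 |⟪∇ φ₀ xbar - 0 - ∇ φ₀ xbar, b j⟫_ℝ|) :=
      ((((hφ₀.continuousAt_gradient.tendsto.comp hfst).sub hsnd).sub_const _).inner
        tendsto_const_nhds).abs
    rw [sub_zero, sub_self, inner_zero_left, abs_zero] at this
    exact this.eventually (ge_mem_nhds hδ)
  have h2 : ∀ᶠ q : Rn n × Rn n in 𝓝 (xbar, 0),
      ∀ i j, |⟪∇ (φ i) q.1 - ∇ (φ i) xbar, b j⟫_ℝ| ≤ δ := by
    refine eventually_all.2 fun i => eventually_all.2 fun j => ?_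
    have : Tendsto (fun q : Rn n × Rn n => |⟪∇ (φ i) q.1 - ∇ (φ i) xbar, b j⟫_ℝ|) (𝓝 (xbar, 0))
        (𝓝 |⟪∇ (φ i) xbar - ∇ (φ i) xbar, b j⟫_ℝ|) :=
      ((((hφ i).continuousAt_gradient.tendsto.comp hfst).sub_const _).inner
        tendsto_const_nhds).abs
    rw [sub_self, inner_zero_left, abs_zero] at this
    exact this.eventually (ge_mem_nhds hδ)
  filter_upwards [h1, h2] with q hq1 hq2 l' hl' hkkt
  set S' := ∑ i, |l' i| with hS'
  have hS'0 : 0 ≤ S' := Finset.sum_nonneg fun i _ => abs_nonneg _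
  have hest : ∀ j, |l' j - l j| ≤ δ * (1 + S') := by
    intro j
    by_cases hj : φ j xbar = 0
    swap
    · rw [hl' j hj, hl.2.1 j hj, sub_self, abs_zero]; positivity
    have e2 : ∀ k : Fin m → ℝ, (∀ i, φ i xbar ≠ 0 → k i = 0) →
        ⟪∑ i, k i • ∇ (φ i) xbar, b j⟫_ℝ = k j := by
      intro k hk
      rw [sum_inner, Finset.sum_eq_single j, inner_smul_left, (hb j hj).1]
      · simp
      · intro i _ hij
        rw [inner_smul_left]
        by_cases hi : φ i xbar = 0
        · rw [(hb i hi).2 j hij.symm, mul_zero]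
        · rw [hk i hi]; simp
      · simp
    have e3 : ∑ i, l' i • ∇ (φ i) q.1 = ∑ i, l' i • ∇ (φ i) xbar
        + ∑ i, l' i • (∇ (φ i) q.1 - ∇ (φ i) xbar) := by
      rw [← Finset.sum_add_distrib]
      exact Finset.sum_congr rfl fun i _ => by rw [smul_sub]; abel
    have e4 := congrArg (fun z => ⟪z, b j⟫_ℝ) hkkt
    have e5 := congrArg (fun z => ⟪z, b j⟫_ℝ) hl.2.2
    simp only [e3, inner_add_left, inner_zero_left, e2 l' hl', e2 l hl.2.1] at e4 e5
    have e6 : |⟪∑ i, l' i • (∇ (φ i) q.1 - ∇ (φ i) xbar), b j⟫_ℝ| ≤ δ * S' := by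
      rw [sum_inner, hS', Finset.mul_sum]
      refine (Finset.abs_sum_le_sum_abs _ _).trans (Finset.sum_le_sum fun i _ => ?_)
      rw [inner_smul_left, abs_mul, conj_trivial, mul_comm]
      gcongr
      exact hq2 i j
    have e7 := hq1 j
    rw [inner_sub_left] at e7
    rw [abs_le] at e6 e7 ⊢
    constructor <;> linarith
  -- summation absorbs the unknown `S'` into the left-hand side
  have hsum : S' ≤ S + m * (δ * (1 + S')) := by
    have : ∀ i ∈ Finset.univ, |l' i| ≤ |l i| + δ * (1 + S') := fun i _ => by
      have := hest i
      have := abs_sub_abs_le_abs_sub (l' i) (l i)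
      linarith
    refine (Finset.sum_le_sum this).trans (le_of_eq ?_)
    rw [Finset.sum_add_distrib]
    simp [hS]
  have hS'le : S' ≤ 2 * S + 1 := by
    have : (m : ℝ) * δ * (1 + S') ≤ 1 / 2 * (1 + S') := by gcongr
    linarith
  intro i
  refine (hest i).trans (le_trans ?_ hδ1)
  exact mul_le_mul_of_nonneg_left (by linarith) hδ.le

theorem IsMultiplier.unique (hlicq : LICQ φ xbar) {l l' : Fin m → ℝ}
    (hl : IsMultiplier s φ₀ φ xbar l) (hl' : IsMultiplier s φ₀ φ xbar l') : l' = l := by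
  obtain ⟨b, hb⟩ := exists_dual_family (fun i => ∇ (φ i) xbar) (fun i => φ i xbar = 0) hlicq
  funext j
  by_cases hj : φ j xbar = 0
  swap
  · rw [hl.2.1 j hj, hl'.2.1 j hj]
  have e2 : ∀ k : Fin m → ℝ, IsMultiplier s φ₀ φ xbar k → k j = -⟪∇ φ₀ xbar, b j⟫_ℝ := by
    intro k hk
    have e5 := congrArg (fun z => ⟪z, b j⟫_ℝ) hk.2.2
    simp only [inner_add_left, inner_zero_left] at e5
    rw [sum_inner, Finset.sum_eq_single j, inner_smul_left, (hb j hj).1] at e5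
    · rw [conj_trivial, mul_one] at e5; linarith
    · intro i _ hij
      rw [inner_smul_left]
      by_cases hi : φ i xbar = 0
      · rw [(hb i hi).2 j hij.symm, mul_zero]
      · rw [hk.2.1 i hi]; simp
    · simp
  rw [e2 l hl, e2 l' hl']

/-! ### The Lagrangian -/

theorem gradient_lagrangian_eventuallyEq (hφ₀ : SmoothWithStrictDeriv φ₀ xbar)
    (hφ : ∀ i, SmoothWithStrictDeriv (φ i) xbar) (l : Fin m → ℝ) :
    ∇ (fun x => lagrangian φ₀ φ x l) =ᶠ[𝓝 xbar] fun x => ∇ φ₀ x + ∑ i, l i • ∇ (φ i) x := by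
  filter_upwards [hφ₀.eventually_hasStrictFDerivAt,
    eventually_all.2 fun i => (hφ i).eventually_hasStrictFDerivAt] with x h0 h
  refine HasGradientAt.gradient ?_
  rw [hasGradientAt_iff_hasFDerivAt]
  have hsum := h0.hasFDerivAt.add (HasFDerivAt.fun_sum (u := Finset.univ)
    fun i _ => (h i).hasFDerivAt.const_mul (l i))
  have he : InnerProductSpace.toDual ℝ (Rn n) (∇ φ₀ x + ∑ i, l i • ∇ (φ i) x) =
      innerSL ℝ (∇ φ₀ x) + ∑ i, l i • innerSL ℝ (∇ (φ i) x) := by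
    ext u
    simp only [InnerProductSpace.toDual_apply_apply, inner_add_left, sum_inner, inner_smul_left,
      conj_trivial, add_apply, sum_apply, smul_apply, innerSL_apply_apply, smul_eq_mul]
  rw [he]
  exact hsum

theorem smooth_lagrangian (hφ₀ : SmoothWithStrictDeriv φ₀ xbar)
    (hφ : ∀ i, SmoothWithStrictDeriv (φ i) xbar) (l : Fin m → ℝ) :
    SmoothWithStrictDeriv (fun x => lagrangian φ₀ φ x l) xbar := by
  choose H hH using fun i => (hφ i).2
  obtain ⟨H₀, hH₀⟩ := hφ₀.2
  refine ⟨hφ₀.1.add (ContDiffAt.sum fun i _ => contDiffAt_const.mul (hφ i).1),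
    H₀ + ∑ i, l i • H i, ?_⟩
  refine HasStrictFDerivAt.congr_of_eventuallyEq ?_
    (gradient_lagrangian_eventuallyEq hφ₀ hφ l).symm
  exact hH₀.add (HasStrictFDerivAt.fun_sum fun i _ => (hH i).const_smul (l i))

theorem lagrangian_le_of_feasible {l : Fin m → ℝ} (hl : ∀ i : Fin m, i.val < s → 0 ≤ l i)
    {x : Rn n} (hx : x ∈ feasibleSet s φ) : lagrangian φ₀ φ x l ≤ φ₀ x := by
  have : ∑ i, l i * φ i x ≤ 0 := Finset.sum_nonpos fun i _ => by
    rcases lt_or_ge i.val s with hi | hi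
    · exact mul_nonpos_of_nonneg_of_nonpos (hl i hi) ((hx i).1 hi)
    · rw [(hx i).2 hi, mul_zero]
  rw [lagrangian]; linarith

/-! ### The second-order condition implies tilt stability -/

/-- Uniform quadratic growth: under SSOC, every Karush–Kuhn–Tucker point `x₁` of a tilted problem near
`xbar`, with multiplier `l'` near `l`, satisfies a quadratic growth condition with a fixed modulus.
The Taylor expansion of `lagrangian · l` and Finsler's lemma leave penalty terms
`⟪∇ (φ i) xbar, x - x₁⟫²` for the equalities and the inequalities with `0 < l i`. Such a
constraint is active at `x₁`, so the term is at most of order `(φ i x)² + ε² ‖x - x₁‖²`, and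
`(φ i x)²` is dominated by the first-order gain `-l' i * φ i x`. -/
theorem uniform_growth (hφ₀ : SmoothWithStrictDeriv φ₀ xbar)
    (hφ : ∀ i, SmoothWithStrictDeriv (φ i) xbar) {l : Fin m → ℝ}
    (hl : IsMultiplier s φ₀ φ xbar l) (hss : SSOC s φ₀ φ xbar l) :
    ∃ κ > 0, ∃ r > 0, ∀ x₁ ∈ ball xbar r, x₁ ∈ feasibleSet s φ →
      ∀ x ∈ ball xbar r, x ∈ feasibleSet s φ → ∀ l' : Fin m → ℝ, (∀ i, |l' i - l i| ≤ r) →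
      (∀ i : Fin m, i.val < s → 0 ≤ l' i) → (∀ i, l' i * φ i x₁ = 0) →
      φ₀ x₁ + ⟪∇ φ₀ x₁ + ∑ i, l' i • ∇ (φ i) x₁, x - x₁⟫_ℝ + κ * ‖x - x₁‖ ^ 2 ≤ φ₀ x := by
  classical
  obtain ⟨c, hc, C, hC, hfin⟩ := exists_coercive_add_penalty (hessLagrangian φ₀ φ xbar l)
    (fun i => ∇ (φ i) xbar) (fun i : Fin m => s ≤ i.val ∨ 0 < l i) (fun u hu => hss u hu)
  choose B hB0 hB using fun i => (hφ i).exists_eventually_quadratic_bound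
  set D := 1 + ∑ i, (B i + C) with hD
  have hD0 : 0 < D := by
    have : 0 ≤ ∑ i, (B i + C) := Finset.sum_nonneg fun i _ => add_nonneg (hB0 i) hC.le
    linarith
  obtain ⟨ε, hε, hε1, hεD⟩ : ∃ ε > 0, ε ≤ 1 ∧ ε * D ≤ c / 4 := by
    refine ⟨min 1 (c / 4 / D), by positivity, min_le_left _ _, ?_⟩
    rw [← le_div_iff₀ hD0]; exact min_le_right _ _
  have hfst : Tendsto (fun q : Rn n × Rn n => q.1) (𝓝 (xbar, xbar)) (𝓝 xbar) :=
    continuous_fst.tendsto _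
  have hsnd : Tendsto (fun q : Rn n × Rn n => q.2) (𝓝 (xbar, xbar)) (𝓝 xbar) :=
    continuous_snd.tendsto _
  have h1 := (smooth_lagrangian hφ₀ hφ l).eventually_taylor hε
  have h2 := eventually_all.2 hB
  have h3 : ∀ᶠ q : Rn n × Rn n in 𝓝 (xbar, xbar), ∀ i,
      |φ i q.1 - φ i q.2 - ⟪∇ (φ i) xbar, q.1 - q.2⟫_ℝ| ≤ ε * ‖q.1 - q.2‖ :=
    eventually_all.2 fun i => (hφ i).hasStrictFDerivAt.isLittleO.def hε
  have h4 : ∀ᶠ q : Rn n × Rn n in 𝓝 (xbar, xbar), ∀ i, 0 < l i → C * |φ i q.1| ≤ l i / 2 := by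
    refine eventually_all.2 fun i => ?_
    by_cases hi : 0 < l i
    · have h0 : φ i xbar = 0 := by
        by_contra h
        exact hi.ne' (hl.2.1 i h)
      have : Tendsto (fun q : Rn n × Rn n => C * |φ i q.1|) (𝓝 (xbar, xbar))
          (𝓝 (C * |φ i xbar|)) := (((hφ i).continuousAt.tendsto.comp hfst).abs).const_mul C
      rw [h0, abs_zero, mul_zero] at this
      filter_upwards [this.eventually (ge_mem_nhds (half_pos hi))] with q hq _ using hq
    · exact Eventually.of_forall fun q h => absurd h hi
  have h5 := hsnd.eventually (gradient_lagrangian_eventuallyEq hφ₀ hφ l)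
  obtain ⟨r₁, hr₁, hr⟩ := Metric.eventually_nhds_iff_ball.1
    (h1.and (h2.and (h3.and (h4.and h5))))
  have h6 : ∀ᶠ r in 𝓝[>] (0 : ℝ), ∀ i, 0 < l i → r ≤ l i / 2 := by
    refine eventually_all.2 fun i => ?_
    by_cases hi : 0 < l i
    · filter_upwards [nhdsWithin_le_nhds (ge_mem_nhds (half_pos hi))] with r hr _ using hr
    · exact Eventually.of_forall fun q h => absurd h hi
  have h7 : ∀ᶠ r in 𝓝[>] (0 : ℝ), 0 < r := self_mem_nhdsWithin
  have h8 : ∀ᶠ r in 𝓝[>] (0 : ℝ), r ≤ r₁ := nhdsWithin_le_nhds (ge_mem_nhds hr₁)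
  have h9 : ∀ᶠ r in 𝓝[>] (0 : ℝ), r ≤ ε := nhdsWithin_le_nhds (ge_mem_nhds hε)
  obtain ⟨r, hr0, hrl, hrr, hrε⟩ := (h7.and (h6.and (h8.and h9))).exists
  refine ⟨c / 4, by positivity, r, hr0, fun x₁ hx₁ hf₁ x hx hf l' hll' hl' hcomp => ?_⟩
  have hmem : (x, x₁) ∈ ball (xbar, xbar) r₁ := by
    rw [← ball_prod_same]
    exact ⟨ball_subset_ball hrr hx, ball_subset_ball hrr hx₁⟩
  obtain ⟨g1, g2, g3, g4, g5⟩ := hr _ hmem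
  dsimp only at g1 g2 g3 g4 g5
  rw [g5] at g1
  set w := x - x₁ with hw
  have hterm : ∀ i, l i * φ i x - l i * φ i x₁ + (l' i - l i) * ⟪∇ (φ i) x₁, w⟫_ℝ ≤
      ε * (B i + C) * ‖w‖ ^ 2 -
        C / 2 * (if s ≤ i.val ∨ 0 < l i then ⟪∇ (φ i) xbar, w⟫_ℝ ^ 2 else 0) := by
    intro i
    have e1 : -((l' i - l i) * (φ i x - φ i x₁ - ⟪∇ (φ i) x₁, w⟫_ℝ)) ≤ ε * (B i * ‖w‖ ^ 2) := by
      refine (neg_le_abs _).trans ?_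
      rw [abs_mul]
      exact mul_le_mul ((hll' i).trans hrε) (g2 i) (abs_nonneg _) hε.le
    have e2 : l' i * φ i x ≤ C * ε * ‖w‖ ^ 2 -
        C / 2 * (if s ≤ i.val ∨ 0 < l i then ⟪∇ (φ i) xbar, w⟫_ℝ ^ 2 else 0) := by
      split_ifs with hi
      · have hφ₁ : φ i x₁ = 0 := by
          rcases lt_or_ge i.val s with his | his
          · have hli : 0 < l i := hi.resolve_left (by omega)
            have := (abs_le.1 (hll' i)).1
            have := hrl i hli
            exact (mul_eq_zero.1 (hcomp i)).resolve_left (by linarith)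
          · exact (hf₁ i).2 his
        have e3 := g3 i
        rw [hφ₁, sub_zero] at e3
        have e4 : ⟪∇ (φ i) xbar, w⟫_ℝ ^ 2 ≤ 2 * φ i x ^ 2 + 2 * (ε * ‖w‖ ^ 2) := by
          have e5 : (φ i x - ⟪∇ (φ i) xbar, w⟫_ℝ) ^ 2 ≤ (ε * ‖w‖) ^ 2 :=
            sq_le_sq' (by linarith [(abs_le.1 e3).1]) (abs_le.1 e3).2
          have e6 : (ε * ‖w‖) ^ 2 ≤ ε * ‖w‖ ^ 2 := by
            rw [mul_pow]
            exact mul_le_mul_of_nonneg_right (by nlinarith) (sq_nonneg _)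
          nlinarith [sq_nonneg (2 * φ i x - ⟪∇ (φ i) xbar, w⟫_ℝ)]
        have e7 : l' i * φ i x ≤ - (C * φ i x ^ 2) := by
          rcases lt_or_ge i.val s with his | his
          · have hli : 0 < l i := hi.resolve_left (by omega)
            have k1 := (abs_le.1 (hll' i)).1
            have k2 := hrl i hli
            have k3 := g4 i hli
            have k4 := (hf i).1 his
            rw [abs_of_nonpos k4] at k3
            nlinarith
          · rw [(hf i).2 his]; simp
        nlinarith [mul_le_mul_of_nonneg_left e4 hC.le]
      · push Not at hi
        have : l' i * φ i x ≤ 0 :=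
          mul_nonpos_of_nonneg_of_nonpos (hl' i hi.1) ((hf i).1 hi.1)
        have : 0 ≤ C * ε * ‖w‖ ^ 2 := by positivity
        linarith
    have e8 := hcomp i
    linarith
  have hsum := Finset.sum_le_sum fun i (_ : i ∈ Finset.univ) => hterm i
  rw [Finset.sum_add_distrib, Finset.sum_sub_distrib, Finset.sum_sub_distrib, ← Finset.mul_sum,
    ← Finset.sum_mul, ← Finset.mul_sum] at hsum
  have hsplit : ∑ i, (l' i - l i) * ⟪∇ (φ i) x₁, w⟫_ℝ =
      ⟪∑ i, l' i • ∇ (φ i) x₁, w⟫_ℝ - ⟪∑ i, l i • ∇ (φ i) x₁, w⟫_ℝ := by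
    rw [sum_inner, sum_inner, ← Finset.sum_sub_distrib]
    exact Finset.sum_congr rfl fun i _ => by
      rw [inner_smul_left, inner_smul_left]; simp only [conj_trivial]; ring
  have hfw : c * ‖w‖ ^ 2 ≤ ⟪w, hessLagrangian φ₀ φ xbar l w⟫_ℝ + C * ∑ i : Fin m,
      if s ≤ i.val ∨ 0 < l i then ⟪∇ (φ i) xbar, w⟫_ℝ ^ 2 else 0 := hfin w
  have hg1 := (abs_le.1 g1).1
  rw [inner_add_left] at hg1 ⊢
  simp only [lagrangian] at hg1
  rw [hsplit] at hsum
  have hDw : ε * D * ‖w‖ ^ 2 ≤ c / 4 * ‖w‖ ^ 2 := by gcongr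
  have hDe : ε * D * ‖w‖ ^ 2 = ε * ‖w‖ ^ 2 + ε * (∑ i, (B i + C)) * ‖w‖ ^ 2 := by
    rw [hD]; ring
  change -(ε * ‖w‖ ^ 2) ≤ _ - _ - _ - ⟪w, hessLagrangian φ₀ φ xbar l w⟫_ℝ / 2 at hg1
  linarith

theorem mem_tiltArgmin_extObjective_iff (hx : xbar ∈ feasibleSet s φ) {γ : ℝ} (hγ : 0 < γ)
    {y x : Rn n} : x ∈ tiltArgmin (extObjective s φ₀ φ) xbar γ y ↔
      (x ∈ closedBall xbar γ ∧ x ∈ feasibleSet s φ) ∧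
        ∀ z ∈ closedBall xbar γ, z ∈ feasibleSet s φ → φ₀ x - ⟪y, x⟫_ℝ ≤ φ₀ z - ⟪y, z⟫_ℝ := by
  have hval : ∀ z ∈ feasibleSet s φ, extObjective s φ₀ φ z - extObjective s φ₀ φ xbar -
      ((⟪y, z - xbar⟫_ℝ : ℝ) : EReal) = ((φ₀ z - φ₀ xbar - ⟪y, z - xbar⟫_ℝ : ℝ) : EReal) := by
    intro z hz
    rw [extObjective, extObjective, if_pos hz, if_pos hx]
    push_cast
    rfl
  have htop : ∀ z ∉ feasibleSet s φ, extObjective s φ₀ φ z - extObjective s φ₀ φ xbar -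
      ((⟪y, z - xbar⟫_ℝ : ℝ) : EReal) = ⊤ := by
    intro z hz
    rw [extObjective, extObjective, if_neg hz, if_pos hx, EReal.top_sub_coe, EReal.top_sub_coe]
  rw [tiltArgmin, Set.mem_ofPred_eq, isMinOn_iff]
  constructor
  · rintro ⟨h1, h2⟩
    have hxf : x ∈ feasibleSet s φ := by
      by_contra hcon
      have := h2 xbar (mem_closedBall_self hγ.le)
      rw [htop x hcon, hval xbar hx, top_le_iff] at this
      exact EReal.coe_ne_top _ this
    refine ⟨⟨h1, hxf⟩, fun z hz hzf => ?_⟩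
    have := h2 z hz
    rw [hval x hxf, hval z hzf, EReal.coe_le_coe_iff, inner_sub_right, inner_sub_right] at this
    linarith
  · rintro ⟨⟨h1, hxf⟩, h2⟩
    refine ⟨h1, fun z hz => ?_⟩
    by_cases hzf : z ∈ feasibleSet s φ
    · rw [hval x hxf, hval z hzf, EReal.coe_le_coe_iff, inner_sub_right, inner_sub_right]
      linarith [h2 z hz hzf]
    · rw [htop z hzf]; exact le_top

theorem isCompact_closedBall_inter_feasibleSet {γ : ℝ}
    (hφ : ∀ i, ContinuousOn (φ i) (closedBall xbar γ)) :
    IsCompact (closedBall xbar γ ∩ feasibleSet s φ) := by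
  refine (isCompact_closedBall xbar γ).of_isClosed_subset ?_ Set.inter_subset_left
  have : closedBall xbar γ ∩ feasibleSet s φ = closedBall xbar γ ∩
      ⋂ i, closedBall xbar γ ∩ φ i ⁻¹' (if i.val < s then Set.Iic 0 else {0}) := by
    ext x
    simp only [Set.mem_inter_iff, Set.mem_iInter, Set.mem_preimage]
    refine and_congr_right fun hx => forall_congr' fun i => ?_
    rcases lt_or_ge i.val s with hi | hi
    · simp [hx, hi]
    · simp [hx, hi, not_lt.2 hi]
  rw [this]
  refine isClosed_closedBall.inter (isClosed_iInter fun i => ?_)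
  refine (hφ i).preimage_isClosed_of_isClosed isClosed_closedBall ?_
  split_ifs
  · exact isClosed_Iic
  · exact isClosed_singleton

/-- SSOC implies tilt stability. Growth at `xbar` keeps the minimizers for small tilts inside the ball,
so that they are Karush–Kuhn–Tucker points, and adding the growth inequalities at two of them gives
`2 * κ * ‖x₁ - x₂‖² ≤ ⟪y₁ - y₂, x₁ - x₂⟫`, hence uniqueness and Lipschitz continuity. -/
theorem isTiltStableMin_of_ssoc (hfeas : xbar ∈ feasibleSet s φ)
    (hφ₀ : SmoothWithStrictDeriv φ₀ xbar) (hφ : ∀ i, SmoothWithStrictDeriv (φ i) xbar)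
    (hlicq : LICQ φ xbar) {l : Fin m → ℝ} (hl : IsMultiplier s φ₀ φ xbar l)
    (hss : SSOC s φ₀ φ xbar l) : IsTiltStableMin s φ₀ φ xbar := by
  obtain ⟨κ, hκ, r, hr, hgrow⟩ := uniform_growth hφ₀ hφ hl hss
  have hcont : ∀ᶠ x in 𝓝 xbar, ContinuousAt φ₀ x ∧ ∀ i, ContinuousAt (φ i) x :=
    (hφ₀.eventually_hasStrictFDerivAt.mono fun _ h => h.continuousAt).and
      (eventually_all.2 fun i => (hφ i).eventually_hasStrictFDerivAt.mono
        fun _ h => h.continuousAt)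
  obtain ⟨γ₀, hγ₀, hγc⟩ := Metric.eventually_nhds_iff_ball.1 hcont
  obtain ⟨γ, hγ, hγr, hγγ⟩ : ∃ γ > 0, γ < r ∧ γ < γ₀ :=
    ⟨min r γ₀ / 2, by positivity, by
      have := min_le_left r γ₀
      have : 0 < min r γ₀ := lt_min hr hγ₀
      linarith, by
      have := min_le_right r γ₀
      have : 0 < min r γ₀ := lt_min hr hγ₀
      linarith⟩
  have hballr : closedBall xbar γ ⊆ ball xbar r := closedBall_subset_ball hγr
  have hballγ : closedBall xbar γ ⊆ ball xbar γ₀ := closedBall_subset_ball hγγ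
  have hex : ∀ y, ∃ x, x ∈ tiltArgmin (extObjective s φ₀ φ) xbar γ y := by
    intro y
    have hcomp : IsCompact (closedBall xbar γ ∩ feasibleSet s φ) :=
      isCompact_closedBall_inter_feasibleSet fun i x hx =>
        ((hγc x (hballγ hx)).2 i).continuousWithinAt
    have hcf : ContinuousOn (fun x => φ₀ x - ⟪y, x⟫_ℝ) (closedBall xbar γ ∩ feasibleSet s φ) := by
      refine ContinuousOn.sub (fun x hx => (hγc x (hballγ hx.1)).1.continuousWithinAt) ?_
      exact (by fun_prop : Continuous fun x : Rn n => ⟪y, x⟫_ℝ).continuousOn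
    obtain ⟨x, hx, hmin⟩ := hcomp.exists_isMinOn ⟨xbar, mem_closedBall_self hγ.le, hfeas⟩ hcf
    exact ⟨x, (mem_tiltArgmin_extObjective_iff hfeas hγ).2 ⟨hx, fun z hz hzf =>
      isMinOn_iff.1 hmin z ⟨hz, hzf⟩⟩⟩
  have hgrow0 : ∀ z ∈ closedBall xbar γ, z ∈ feasibleSet s φ →
      φ₀ xbar + κ * ‖z - xbar‖ ^ 2 ≤ φ₀ z := by
    intro z hz hzf
    have := hgrow xbar (mem_ball_self hr) hfeas z (hballr hz) hzf l (by simp [hr.le]) hl.1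
      (fun i => by
        by_cases h : φ i xbar = 0
        · rw [h, mul_zero]
        · rw [hl.2.1 i h, zero_mul])
    rwa [hl.2.2, inner_zero_left, add_zero] at this
  have hloc : ∀ y x, x ∈ tiltArgmin (extObjective s φ₀ φ) xbar γ y → κ * ‖x - xbar‖ ≤ ‖y‖ := by
    intro y x hx
    obtain ⟨⟨hx1, hx2⟩, hx3⟩ := (mem_tiltArgmin_extObjective_iff hfeas hγ).1 hx
    have h1 := hx3 xbar (mem_closedBall_self hγ.le) hfeas
    have h2 := hgrow0 x hx1 hx2
    have h3 := real_inner_le_norm y (x - xbar)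
    rw [inner_sub_right] at h3
    rcases (norm_nonneg (x - xbar)).eq_or_lt with h0 | h0
    · rw [← h0, mul_zero]; exact norm_nonneg _
    · refine le_of_mul_le_mul_right ?_ h0
      linarith
  have hinact : ∀ᶠ x in 𝓝 xbar, ∀ i, φ i xbar ≠ 0 → φ i x ≠ 0 := by
    refine eventually_all.2 fun i => ?_
    by_cases hi : φ i xbar = 0
    · exact Eventually.of_forall fun x h => absurd hi h
    · filter_upwards [(hφ i).continuousAt.eventually_ne hi] with x hx _ using hx
  have hgood : ∀ᶠ x in 𝓝 xbar, HasGradientAt φ₀ (∇ φ₀ x) x ∧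
      (∀ i, HasStrictFDerivAt (φ i) (innerSL ℝ (∇ (φ i) x)) x) ∧ LICQ φ x ∧
      ∀ i, φ i xbar ≠ 0 → φ i x ≠ 0 :=
    hφ₀.eventually_hasGradientAt.and ((eventually_all.2 fun i =>
      (hφ i).eventually_hasStrictFDerivAt).and ((eventually_licq hφ hlicq).and hinact))
  obtain ⟨η, hη, hηg⟩ := Metric.eventually_nhds_iff_ball.1
    (((continuous_fst.tendsto (xbar, (0 : Rn n))).eventually hgood).and
      (eventually_multiplier_near hφ₀ hφ hlicq hl hr))
  set δ := min η (κ * min η γ) with hδ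
  have hδ0 : 0 < δ := by positivity
  have hgrowy : ∀ y ∈ ball (0 : Rn n) δ, ∀ x ∈ tiltArgmin (extObjective s φ₀ φ) xbar γ y,
      ∀ z ∈ closedBall xbar γ, z ∈ feasibleSet s φ →
      φ₀ x + ⟪y, z - x⟫_ℝ + κ * ‖z - x‖ ^ 2 ≤ φ₀ z := by
    intro y hy x hx z hz hzf
    have hyδ : ‖y‖ < δ := mem_ball_zero_iff.1 hy
    have hxn : ‖x - xbar‖ < min η γ := by
      refine lt_of_mul_lt_mul_left ?_ hκ.le
      exact (hloc y x hx).trans_lt (hyδ.trans_le (min_le_right _ _))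
    obtain ⟨⟨hx1, hx2⟩, hx3⟩ := (mem_tiltArgmin_extObjective_iff hfeas hγ).1 hx
    have hmem : (x, y) ∈ ball (xbar, (0 : Rn n)) η := by
      rw [← ball_prod_same]
      refine ⟨mem_ball_iff_norm.2 (hxn.trans_le (min_le_left _ _)),
        mem_ball_zero_iff.2 (hyδ.trans_le (min_le_left _ _))⟩
    obtain ⟨⟨k1, k2, k3, k4⟩, k5⟩ := hηg _ hmem
    dsimp only at k1 k2 k3 k4 k5
    have hgrad : HasGradientAt (fun z => φ₀ z - ⟪y, z⟫_ℝ) (∇ φ₀ x - y) x := by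
      rw [hasGradientAt_iff_hasFDerivAt, map_sub]
      exact k1.hasFDerivAt.sub (InnerProductSpace.toDual ℝ (Rn n) y).hasFDerivAt
    obtain ⟨l', hl1, hl2, hl3⟩ := exists_multiplier_of_local_min hgrad k2 k3 hx2 (by
      have : ball xbar γ ∈ 𝓝 x := isOpen_ball.mem_nhds
        (mem_ball_iff_norm.2 (hxn.trans_le (min_le_right _ _)))
      filter_upwards [this] with z hz hzf using hx3 z (ball_subset_closedBall hz) hzf)
    have hnear := k5 l' (fun i hi => hl2 i (k4 i hi)) hl3
    have hy' : ∇ φ₀ x + ∑ i, l' i • ∇ (φ i) x = y := by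
      rw [← sub_eq_zero, ← hl3]; abel
    have := hgrow x (hballr hx1) hx2 z (hballr hz) hzf l' hnear hl1 (fun i => by
      by_cases h : φ i x = 0
      · rw [h, mul_zero]
      · rw [hl2 i h, zero_mul])
    rwa [hy'] at this
  have hLip : ∀ y₁ ∈ ball (0 : Rn n) δ, ∀ y₂ ∈ ball (0 : Rn n) δ,
      ∀ x₁ ∈ tiltArgmin (extObjective s φ₀ φ) xbar γ y₁,
      ∀ x₂ ∈ tiltArgmin (extObjective s φ₀ φ) xbar γ y₂, ‖x₁ - x₂‖ ≤ κ⁻¹ * ‖y₁ - y₂‖ := by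
    intro y₁ hy₁ y₂ hy₂ x₁ hx₁ x₂ hx₂
    obtain ⟨⟨a1, a2⟩, -⟩ := (mem_tiltArgmin_extObjective_iff hfeas hγ).1 hx₁
    obtain ⟨⟨b1, b2⟩, -⟩ := (mem_tiltArgmin_extObjective_iff hfeas hγ).1 hx₂
    have e1 := hgrowy y₁ hy₁ x₁ hx₁ x₂ b1 b2
    have e2 := hgrowy y₂ hy₂ x₂ hx₂ x₁ a1 a2
    have e3 := real_inner_le_norm (y₁ - y₂) (x₁ - x₂)
    have e4 : ⟪y₁, x₂ - x₁⟫_ℝ = - ⟪y₁, x₁ - x₂⟫_ℝ := by rw [← inner_neg_right, neg_sub]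
    rw [norm_sub_rev] at e1
    rw [inner_sub_left] at e3
    have e5 : 0 ≤ κ * ‖x₁ - x₂‖ ^ 2 := by positivity
    rw [inv_mul_eq_div, le_div_iff₀ hκ]
    rcases (norm_nonneg (x₁ - x₂)).eq_or_lt with h0 | h0
    · rw [← h0, zero_mul]; exact norm_nonneg _
    · refine le_of_mul_le_mul_right ?_ h0
      linarith
  choose M hM using hex
  have hsub : ∀ y ∈ ball (0 : Rn n) δ, ∀ x ∈ tiltArgmin (extObjective s φ₀ φ) xbar γ y,
      x = M y := by
    intro y hy x hx
    have := hLip y hy y hy x hx (M y) (hM y)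
    rw [sub_self, norm_zero, mul_zero] at this
    exact sub_eq_zero.1 (norm_le_zero_iff.1 this)
  have hfin : extObjective s φ₀ φ xbar = ((φ₀ xbar : ℝ) : EReal) := if_pos hfeas
  refine ⟨by rw [hfin]; exact EReal.coe_ne_bot _, by rw [hfin]; exact EReal.coe_ne_top _, γ, hγ,
    ball 0 δ, ball_mem_nhds _ hδ0, M, (Real.toNNReal κ⁻¹), fun y hy => ?_, ?_, ?_⟩
  · exact Set.eq_singleton_iff_unique_mem.2 ⟨hM y, hsub y hy⟩
  · refine LipschitzOnWith.of_dist_le_mul fun y hy y' hy' => ?_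
    rw [dist_eq_norm, dist_eq_norm, Real.coe_toNNReal _ (by positivity)]
    exact hLip y hy y' hy' _ (hM y) _ (hM y')
  · have := hloc 0 (M 0) (hM 0)
    rw [norm_zero] at this
    have h2 : ‖M 0 - xbar‖ ≤ 0 := by
      by_contra hcon
      push Not at hcon
      linarith [mul_pos hκ hcon]
    exact sub_eq_zero.1 (norm_le_zero_iff.1 h2)

/-! ### Tilt stability implies the second-order condition -/

theorem IsTiltStableMin.exists_isMultiplier (hfeas : xbar ∈ feasibleSet s φ)
    (hφ₀ : SmoothWithStrictDeriv φ₀ xbar) (hφ : ∀ i, SmoothWithStrictDeriv (φ i) xbar)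
    (hlicq : LICQ φ xbar) (h : IsTiltStableMin s φ₀ φ xbar) :
    ∃ l, IsMultiplier s φ₀ φ xbar l := by
  obtain ⟨-, -, γ, hγ, V, hV, M, K, hM, -, hM0⟩ := h
  have hx : xbar ∈ tiltArgmin (extObjective s φ₀ φ) xbar γ 0 := by
    rw [hM 0 (mem_of_mem_nhds hV), hM0]; rfl
  have hmin := ((mem_tiltArgmin_extObjective_iff hfeas hγ).1 hx).2
  refine exists_multiplier_of_local_min hφ₀.eventually_hasGradientAt.self_of_nhds
    (fun i => (hφ i).hasStrictFDerivAt) hlicq hfeas ?_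
  filter_upwards [closedBall_mem_nhds xbar hγ] with z hz hzf
  simpa using hmin z hz hzf

/-- The data of tilt stability on a closed ball of tilts small enough for the minimizers to stay in a
prescribed neighbourhood of `xbar`, with a positive Lipschitz constant. -/
theorem IsTiltStableMin.exists_lipschitz_argmin (hfeas : xbar ∈ feasibleSet s φ)
    (h : IsTiltStableMin s φ₀ φ xbar) {r : ℝ} (hr : 0 < r) :
    ∃ γ > 0, ∃ δ > 0, ∃ K > 0, ∃ M : Rn n → Rn n, M 0 = xbar ∧
      (∀ y ∈ closedBall (0 : Rn n) δ, M y ∈ ball xbar r) ∧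
      (∀ y ∈ closedBall (0 : Rn n) δ, M y ∈ closedBall xbar γ ∩ feasibleSet s φ) ∧
      (∀ y ∈ closedBall (0 : Rn n) δ, ∀ z ∈ closedBall xbar γ ∩ feasibleSet s φ,
        φ₀ (M y) - ⟪y, M y⟫_ℝ ≤ φ₀ z - ⟪y, z⟫_ℝ) ∧
      ∀ y ∈ closedBall (0 : Rn n) δ, ∀ y' ∈ closedBall (0 : Rn n) δ,
        ‖M y - M y'‖ ≤ K * ‖y - y'‖ := by
  obtain ⟨-, -, γ, hγ, V, hV, M, K, hM, hLip, hM0⟩ := h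
  obtain ⟨δ₀, hδ₀, hδV⟩ := Metric.nhds_basis_closedBall.mem_iff.1 hV
  have hK : 0 < (K : ℝ) + 1 := by positivity
  set δ := min δ₀ (r / (2 * (K + 1))) with hδ
  have hδ0 : 0 < δ := by positivity
  have hsub : closedBall (0 : Rn n) δ ⊆ V :=
    (closedBall_subset_closedBall (min_le_left _ _)).trans hδV
  have hmem : ∀ y ∈ closedBall (0 : Rn n) δ, M y ∈ tiltArgmin (extObjective s φ₀ φ) xbar γ y :=
    fun y hy => by rw [hM y (hsub hy)]; rfl
  have hL : ∀ y ∈ closedBall (0 : Rn n) δ, ∀ y' ∈ closedBall (0 : Rn n) δ,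
        ‖M y - M y'‖ ≤ (K + 1) * ‖y - y'‖ := fun y hy y' hy' => by
    have h1 := hLip.dist_le_mul y (hsub hy) y' (hsub hy')
    rw [dist_eq_norm, dist_eq_norm] at h1
    linarith [norm_nonneg (y - y')]
  refine ⟨γ, hγ, δ, hδ0, K + 1, hK, M, hM0, fun y hy => ?_, fun y hy => ?_, fun y hy z hz => ?_, hL⟩
  · have h1 := hL y hy 0 (mem_closedBall_self hδ0.le)
    rw [hM0, sub_zero] at h1
    rw [mem_ball_iff_norm]
    have h2 : ‖y‖ ≤ r / (2 * (K + 1)) := (mem_closedBall_zero_iff.1 hy).trans (min_le_right _ _)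
    calc ‖M y - xbar‖ ≤ (K + 1) * ‖y‖ := h1
      _ ≤ (K + 1) * (r / (2 * (K + 1))) := by gcongr
      _ = r / 2 := by field_simp
      _ < r := half_lt_self hr
  · exact ((mem_tiltArgmin_extObjective_iff hfeas hγ).1 (hmem y hy)).1
  · exact ((mem_tiltArgmin_extObjective_iff hfeas hγ).1 (hmem y hy)).2 z hz.1 hz.2

/-- Under tilt stability, all feasible points near `xbar` that are complementary to `l` satisfy
quadratic growth with a fixed modulus: such a point `q.2` minimizes the problem tilted by
`∇ (lagrangian · l) q.2`. -/
theorem IsTiltStableMin.exists_uniform_growth (hfeas : xbar ∈ feasibleSet s φ)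
    (hφ₀ : SmoothWithStrictDeriv φ₀ xbar) (hφ : ∀ i, SmoothWithStrictDeriv (φ i) xbar)
    (h : IsTiltStableMin s φ₀ φ xbar) {l : Fin m → ℝ} (hl : IsMultiplier s φ₀ φ xbar l) :
    ∃ κ > 0, ∀ᶠ q : Rn n × Rn n in 𝓝 (xbar, xbar), q.1 ∈ feasibleSet s φ →
      q.2 ∈ feasibleSet s φ → (∀ i, l i * φ i q.2 = 0) →
      φ₀ q.2 + ⟪∇ (fun x => lagrangian φ₀ φ x l) q.2, q.1 - q.2⟫_ℝ + κ * ‖q.1 - q.2‖ ^ 2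
        ≤ φ₀ q.1 := by
  have hL := smooth_lagrangian hφ₀ hφ l
  obtain ⟨B, hB0, hB⟩ := hL.exists_eventually_quadratic_bound
  obtain ⟨r, hr, hBr⟩ := Metric.eventually_nhds_iff_ball.1 hB
  obtain ⟨γ, hγ, δ, hδ, K, hK, M, hM0, hMr, hMC, hmin, hLip⟩ :=
    h.exists_lipschitz_argmin hfeas hr
  have hgrad0 : ∇ (fun x => lagrangian φ₀ φ x l) xbar = 0 := by
    rw [(gradient_lagrangian_eventuallyEq hφ₀ hφ l).self_of_nhds]; exact hl.2.2
  refine ⟨1 / (4 * K), by positivity, ?_⟩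
  have hfst : Tendsto (fun q : Rn n × Rn n => q.1) (𝓝 (xbar, xbar)) (𝓝 xbar) :=
    continuous_fst.tendsto _
  have hsnd : Tendsto (fun q : Rn n × Rn n => q.2) (𝓝 (xbar, xbar)) (𝓝 xbar) :=
    continuous_snd.tendsto _
  have hv : Tendsto (fun q : Rn n × Rn n => ‖∇ (fun x => lagrangian φ₀ φ x l) q.2‖)
      (𝓝 (xbar, xbar)) (𝓝 0) := by
    have := (hL.continuousAt_gradient.tendsto.comp hsnd).norm
    rwa [hgrad0, norm_zero] at this
  have h1 : ∀ᶠ q : Rn n × Rn n in 𝓝 (xbar, xbar),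
      2 * δ * ‖∇ (fun x => lagrangian φ₀ φ x l) q.2‖ + 2 * (B + 1) * (φ₀ q.2 - φ₀ xbar)
        < δ ^ 2 := by
    have : Tendsto (fun q : Rn n × Rn n => 2 * δ * ‖∇ (fun x => lagrangian φ₀ φ x l) q.2‖ +
        2 * (B + 1) * (φ₀ q.2 - φ₀ xbar)) (𝓝 (xbar, xbar))
        (𝓝 (2 * δ * 0 + 2 * (B + 1) * (φ₀ xbar - φ₀ xbar))) :=
      (hv.const_mul _).add (((hφ₀.continuousAt.tendsto.comp hsnd).sub_const _).const_mul _)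
    refine this.eventually (gt_mem_nhds ?_)
    rw [sub_self, mul_zero, mul_zero, add_zero]
    positivity
  have h2 : ∀ᶠ q : Rn n × Rn n in 𝓝 (xbar, xbar),
      ‖∇ (fun x => lagrangian φ₀ φ x l) q.2‖ + ‖q.1 - q.2‖ / (2 * K) < δ := by
    have := hv.add ((hfst.sub hsnd).norm.div_const (2 * K))
    refine this.eventually (gt_mem_nhds ?_)
    rw [sub_self, norm_zero, zero_div, add_zero]
    exact hδ
  filter_upwards [h1, h2, hfst.eventually (closedBall_mem_nhds xbar hγ),
    hsnd.eventually (closedBall_mem_nhds xbar hγ), hsnd.eventually (ball_mem_nhds xbar hr)]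
    with q e1 e2 e3 e4 e5 hq1 hq2 hcomp
  have hLq : lagrangian φ₀ φ q.2 l = φ₀ q.2 := by
    rw [lagrangian, Finset.sum_eq_zero fun i _ => hcomp i, add_zero]
  obtain ⟨-, hMv⟩ := argmin_eq_of_lower_quadratic (R := ‖xbar‖ + γ) (c := B) (ρ := B + 1) hδ
    (by positivity) hMC (fun z hz => by
      have := norm_sub_norm_le z xbar
      have := mem_closedBall_iff_norm.1 hz.1
      linarith) hmin hLip ⟨e4, hq2⟩ (by linarith)
    (v := ∇ (fun x => lagrangian φ₀ φ x l) q.2) (fun y hy => by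
      have hmem : (M y, q.2) ∈ ball (xbar, xbar) r := by
        rw [← ball_prod_same]; exact ⟨hMr y hy, e5⟩
      have k1 := (abs_le.1 (hBr _ hmem)).1
      have k2 := lagrangian_le_of_feasible (φ₀ := φ₀) hl.1 (hMC y hy).2
      dsimp only at k1
      rw [hLq] at k1
      linarith) (by rw [hM0]; exact e1)
  have hg := quadratic_growth_of_lipschitz_argmin hK hMC hmin hLip
    (y := ∇ (fun x => lagrangian φ₀ φ x l) q.2) (x := q.1) ⟨e3, hq1⟩ (by rw [hMv]; exact e2.le)
  rw [hMv] at hg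
  rwa [one_div_mul_eq_div]

/-- Tilt stability implies SSOC. For `u` in the strong subspace, the two arcs issuing from `xbar` in
the directions `d` and `d + τ • u` are feasible and complementary to `l`: `d` moves into the
interior of the weakly active inequalities, so the sign of `⟪∇ (φ i) xbar, u⟫` is irrelevant for
them. Along both arcs `φ₀` agrees with the Lagrangian, so uniform growth against the Taylor
expansion of the Lagrangian yields the second-order condition on their difference, which is
`t • τ • u` to first order. -/
theorem IsTiltStableMin.ssoc (hfeas : xbar ∈ feasibleSet s φ)
    (hφ₀ : SmoothWithStrictDeriv φ₀ xbar) (hφ : ∀ i, SmoothWithStrictDeriv (φ i) xbar)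
    (hlicq : LICQ φ xbar) (h : IsTiltStableMin s φ₀ φ xbar) {l : Fin m → ℝ}
    (hl : IsMultiplier s φ₀ φ xbar l) : SSOC s φ₀ φ xbar l := by
  classical
  intro u hu hu0
  obtain ⟨κ, hκ, hgrow⟩ := h.exists_uniform_growth hfeas hφ₀ hφ hl
  have htaylor := (smooth_lagrangian hφ₀ hφ l).eventually_taylor (half_pos hκ)
  obtain ⟨b, hb⟩ := exists_dual_family (fun i => ∇ (φ i) xbar) (fun i => φ i xbar = 0) hlicq
  obtain ⟨Ψ, hΨx, hΨ, hΨφ⟩ := exists_straightening φ _ b _ xbar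
    (fun i => (hφ i).hasStrictFDerivAt) hb
  set d : Rn n := -∑ j : Fin m, (if s ≤ j.val ∨ 0 < l j then 0 else 1 : ℝ) • b j with hd
  have had : ∀ i, φ i xbar = 0 →
      ⟪∇ (φ i) xbar, d⟫_ℝ = -(if s ≤ i.val ∨ 0 < l i then 0 else 1 : ℝ) := by
    intro i hi
    rw [hd, inner_neg_right, inner_sum, Finset.sum_eq_single i, inner_smul_right, (hb i hi).1,
      mul_one]
    · intro j _ hij
      rw [inner_smul_right, (hb i hi).2 j hij, mul_zero]
    · simp
  obtain ⟨τ, hτ, hτu⟩ : ∃ τ : ℝ, (∀ i, τ * ⟪∇ (φ i) xbar, u⟫_ℝ < 1) ∧ 0 < τ := by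
    have h1 : ∀ᶠ τ in 𝓝[>] (0 : ℝ), ∀ i, τ * ⟪∇ (φ i) xbar, u⟫_ℝ < 1 := by
      refine eventually_all.2 fun i => nhdsWithin_le_nhds ?_
      have h2 : Continuous fun τ : ℝ => τ * ⟪∇ (φ i) xbar, u⟫_ℝ := by fun_prop
      have h3 := h2.tendsto 0
      rw [zero_mul] at h3
      exact h3.eventually (gt_mem_nhds one_pos)
    have h4 : ∀ᶠ τ in 𝓝[>] (0 : ℝ), 0 < τ := self_mem_nhdsWithin
    exact (h1.and h4).exists
  have harc : ∀ e : Rn n, (∀ i, φ i xbar = 0 → (s ≤ i.val ∨ 0 < l i) → ⟪∇ (φ i) xbar, e⟫_ℝ = 0) →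
      (∀ i, φ i xbar = 0 → ¬ (s ≤ i.val ∨ 0 < l i) → ⟪∇ (φ i) xbar, e⟫_ℝ ≤ 0) →
      (∀ᶠ t in 𝓝[>] (0 : ℝ), Ψ (xbar + t • e) ∈ feasibleSet s φ ∧
        ∀ i, l i * φ i (Ψ (xbar + t • e)) = 0) ∧
      Tendsto (fun t : ℝ => Ψ (xbar + t • e)) (𝓝[>] 0) (𝓝 xbar) ∧
      Tendsto (fun t : ℝ => t⁻¹ • (Ψ (xbar + t • e) - xbar)) (𝓝[>] 0) (𝓝 e) := by
    intro e he1 he2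
    refine ⟨?_, ?_⟩
    · filter_upwards [eventually_arc_feasible (fun i => (hφ i).continuousAt) hfeas hΨx
        hΨ.continuousAt hΨφ (d := e) (fun i hi _ => by
          by_cases hp : s ≤ i.val ∨ 0 < l i
          · exact (he1 i hi hp).le
          · exact he2 i hi hp) (fun i hi => he1 i ((hfeas i).2 hi) (Or.inl hi))]
        with t ⟨ht1, ht2⟩
      refine ⟨ht1, fun i => ?_⟩
      by_cases hi : φ i xbar = 0
      · by_cases hp : s ≤ i.val ∨ 0 < l i
        · rw [ht2 i hi, he1 i hi hp, mul_zero, mul_zero]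
        · push Not at hp
          rw [le_antisymm hp.2 (hl.1 i hp.1), zero_mul]
      · rw [hl.2.1 i hi, zero_mul]
    · have hline : HasDerivAt (fun t : ℝ => xbar + t • e) e 0 := by
        simpa using ((hasDerivAt_id (0 : ℝ)).smul_const e).const_add xbar
      have hx0 : xbar + (0 : ℝ) • e = xbar := by simp
      have hc : HasDerivAt (fun t : ℝ => Ψ (xbar + t • e)) e 0 := by
        have h : HasFDerivAt Ψ (ContinuousLinearMap.id ℝ (Rn n)) (xbar + (0 : ℝ) • e) := by
          rw [hx0]; exact hΨ.hasFDerivAt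
        exact h.comp_hasDerivAt (0 : ℝ) hline
      have hc1 := hc.continuousAt.tendsto
      have hc2 := hc.tendsto_slope_zero_right
      simp only [zero_add, hx0, hΨx] at hc1 hc2
      exact ⟨hc1.mono_left nhdsWithin_le_nhds, hc2⟩
  obtain ⟨f1, t1, s1⟩ := harc d (fun i hi hp => by rw [had i hi, if_pos hp, neg_zero])
    (fun i hi hp => by rw [had i hi, if_neg hp]; norm_num)
  obtain ⟨f2, t2, s2⟩ := harc (d + τ • u)
    (fun i hi hp => by
      rw [inner_add_right, had i hi, if_pos hp, inner_smul_right, hu i hp]; simp)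
    (fun i hi hp => by
      rw [inner_add_right, had i hi, if_neg hp, inner_smul_right]; linarith [hτ i])
  set w : ℝ → Rn n := fun t => t⁻¹ • (Ψ (xbar + t • (d + τ • u)) - Ψ (xbar + t • d)) with hw
  have hwlim : Tendsto w (𝓝[>] 0) (𝓝 (τ • u)) := by
    have := s2.sub s1
    rw [add_sub_cancel_left] at this
    refine this.congr fun t => ?_
    rw [hw, ← smul_sub, sub_sub_sub_cancel_right]
  have hwin : ∀ᶠ t in 𝓝[>] (0 : ℝ), κ * ‖w t‖ ^ 2 ≤ ⟪w t, hessLagrangian φ₀ φ xbar l (w t)⟫_ℝ := by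
    have ht : Tendsto (fun t : ℝ => (Ψ (xbar + t • (d + τ • u)), Ψ (xbar + t • d))) (𝓝[>] 0)
        (𝓝 (xbar, xbar)) := t2.prodMk_nhds t1
    filter_upwards [f1, f2, ht.eventually hgrow, ht.eventually htaylor, self_mem_nhdsWithin]
      with t ⟨hf1, hz1⟩ ⟨hf2, hz2⟩ hg htay (ht0 : 0 < t)
    have hg' := hg hf2 hf1 hz1
    have htay' := (abs_le.1 htay).2
    have hL : ∀ x, (∀ i, l i * φ i x = 0) → lagrangian φ₀ φ x l = φ₀ x := fun x hx => by
      rw [lagrangian, Finset.sum_eq_zero fun i _ => hx i, add_zero]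
    rw [hL _ hz1, hL _ hz2] at htay'
    change _ - _ - _ - ⟪_, hessLagrangian φ₀ φ xbar l _⟫_ℝ / 2 ≤ _ at htay'
    simp only [hw]
    rw [norm_smul, map_smul, inner_smul_left, inner_smul_right, Real.norm_of_nonneg (by positivity),
      conj_trivial]
    set W := Ψ (xbar + t • (d + τ • u)) - Ψ (xbar + t • d)
    have hk : κ * ‖W‖ ^ 2 ≤ ⟪W, hessLagrangian φ₀ φ xbar l W⟫_ℝ := by linarith
    calc κ * (t⁻¹ * ‖W‖) ^ 2 = t⁻¹ ^ 2 * (κ * ‖W‖ ^ 2) := by ring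
      _ ≤ t⁻¹ ^ 2 * ⟪W, hessLagrangian φ₀ φ xbar l W⟫_ℝ := by gcongr
      _ = _ := by ring
  have hlim := le_of_tendsto_of_tendsto ((hwlim.norm.pow 2).const_mul κ)
    (hwlim.inner (((hessLagrangian φ₀ φ xbar l).continuous.tendsto _).comp hwlim)) hwin
  rw [map_smul, inner_smul_left, inner_smul_right, conj_trivial, norm_smul,
    Real.norm_of_nonneg hτu.le] at hlim
  have hpos : 0 < κ * (τ * ‖u‖) ^ 2 := by
    have := norm_pos_iff.2 hu0
    positivity
  exact pos_of_mul_pos_right (pos_of_mul_pos_right (hpos.trans_le hlim) hτu.le) hτu.le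

end NLP

end

theorem theorem5p2 (n m s : ℕ) (hs : s ≤ m)
    (φ₀ : Rn n → ℝ) (φ : Fin m → Rn n → ℝ) (xbar : Rn n)
    (hfeas : xbar ∈ NLP.feasibleSet s φ)
    (hφ₀ : SmoothWithStrictDeriv φ₀ xbar)
    (hφ : ∀ i, SmoothWithStrictDeriv (φ i) xbar)
    (hlicq : NLP.LICQ φ xbar) :
    (NLP.IsTiltStableMin s φ₀ φ xbar →
      ∃ l : Fin m → ℝ, NLP.IsMultiplier s φ₀ φ xbar l ∧
        (∀ l' : Fin m → ℝ, NLP.IsMultiplier s φ₀ φ xbar l' → l' = l) ∧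
        NLP.SSOC s φ₀ φ xbar l) ∧
    (∀ l : Fin m → ℝ, NLP.IsMultiplier s φ₀ φ xbar l → NLP.SSOC s φ₀ φ xbar l →
      NLP.IsTiltStableMin s φ₀ φ xbar) := by
  refine ⟨fun h => ?_, fun l hl hss => NLP.isTiltStableMin_of_ssoc hfeas hφ₀ hφ hlicq hl hss⟩
  obtain ⟨l, hl⟩ := h.exists_isMultiplier hfeas hφ₀ hφ hlicq
  exact ⟨l, hl, fun l' hl' => hl.unique hlicq hl', h.ssoc hfeas hφ₀ hφ hlicq hl⟩
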